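/- Let $\mathbb{H}$ be the quaternions with modulus $|\cdot|$. For $a,z\in\mathbb{H}^d$ write $a^*z=\sum_j \overline{a_j}z_j$ and $\|z\|=(\sum_j|z_j|^2)^{1/2}$; let ${\rm sign}(w)=w/|w|$ for $0\ne w\in\mathbb{H}$ and ${\rm sign}(0)=1$. For $x,z\in\mathbb{H}^d$ put $$\phi(z)={\rm sign}(x^*z),\qquad {\rm dist}(z,x)=\min_{w\in\mathbb{H},\,|w|=1}\|z-xw\| .$$ Given measurement vectors $\alpha_1,\dots,\alpha_n\in\mathbb{H}^d$, a signal $x\in\mathbb{H}^d$ and a control parameter $\sigma>0$, let $\psi_k=|\alpha_k^*x|$, $\varepsilon_k=\sqrt{\sigma}\,\psi_k$, $$f_\varepsilon(z)=\frac1n\sum_{k=1}^n\Big(\sqrt{|\alpha_k^*z|^2+\varepsilon_k^2}-\sqrt{\psi_k^2+\varepsilon_k^2}\Big)^2,$$ $$\nabla f_\varepsilon(z)=\frac1n\sum_{k=1}^n\Big(1-\frac{\sqrt{\psi_k^2+\varepsilon_k^2}}{\sqrt{|\alpha_k^*z|^2+\varepsilon_k^2}}\Big)\alpha_k\alpha_k^*z$$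 (a summand with $\psi_k=0$ is read as $\alpha_k\alpha_k^*z$). The Quaternionic Perturbed Amplitude Flow (QPAF) with weighting parameter $\gamma\in\mathbb{R}$ and step size $\eta>0$ is as follows. Put $\lambda_0=\big(\frac1n\sum_k\psi_k^2\big)^{1/2}$, let $\nu$ be a normalized eigenvector for the largest standard (right) eigenvalue of the Hermitian matrix $S_{\rm in}=\frac1n\sum_k\big(\gamma-e^{-\psi_k^2/\lambda_0^2}\big)\alpha_k\alpha_k^*$, and set $z_0=\lambda_0\nu$, $z_{t+1}=z_t-\eta\,\nabla f_\varepsilon(z_t)$ for $t\ge 0$. (A standard eigenvalue is $q=a+bi$ with $a\in\mathbb{R}$, $b\ge0$ and $Sv=vq$ for some $v\neq0$; those of a Hermitian matrix are real.) **Theorem.** Let $\sigma>0$ and $\gamma\in\mathbb{R}$. (a) For all $\alpha_1,\dots,\alpha_n,x\in\mathbb{H}^d$, the function $f_\varepsilon$ is (real) differentiable everywhere on $\mathbb{H}^d$, and $\nabla f_\varepsilon$ as displayed above equals twice the generalized $\mathbb{HR}$ gradient of $f_\varepsilon$, whose $l$-th entry at $q$ is $\frac14\big(\partial_{q_{l,a}}f_\varepsilon+i\,\partial_{q_{l,b}}f_\varepsilon+j\,\partial_{q_{l,c}}f_\varepsilon+k\,\partial_{q_{l,d}}f_\varepsilon\big)$,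 where $q_l=q_{l,a}+q_{l,b}i+q_{l,c}j+q_{l,d}k$. (b) There are constants $C,c_1,c_2,\mu,\lambda>0$ with $\lambda\mu<1$, and $0<\rho<1$, depending only on $\sigma$ and $\gamma$, such that the following holds for all $d,n\in\mathbb{N}$ with $n\ge Cd$ and every nonzero $x\in\mathbb{H}^d$. Let the entries of $\alpha_1,\dots,\alpha_n$ be i.i.d. quaternionic Gaussian, with law $\frac12\big(\mathcal{N}(0,1)+\mathcal{N}(0,1)i+\mathcal{N}(0,1)j+\mathcal{N}(0,1)k\big)$ (independent components). Then with probability at least $1-c_1e^{-c_2n}$ all of the following hold: 1. (local regularity condition ${\rm LRC}(\mu,\lambda,\rho)$) for all $z\in\mathbb{H}^d$ with $\|z-x\phi(z)\|\le\rho\|x\|$, $${\rm Re}\big(\nabla f_\varepsilon(z)^*(z-x\phi(z))\big)\ \ge\ \frac{\lambda}{2}\,{\rm dist}^2(z,x)+\frac{\mu}{2}\,\|\nabla f_\varepsilon(z)\|^2;$$ 2. the spectral initial guess exists and lies in this region: a vector $\nu$ as above exists, and for every such $\nu$, ${\rm dist}(z_0,x)\le\rho\|x\|$; 3. (linear convergence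 up to a right quaternion phase) for every such $\nu$, every step size $0<\eta\le\mu$ and every $t\ge0$, $${\rm dist}^2(z_t,x)\le(1-\lambda\eta)^t\,{\rm dist}^2(z_0,x).$$ -/

import Mathlib

open scoped Quaternion BigOperators
open MeasureTheory ProbabilityTheory

noncomputable section

namespace QPAF

/-- `ℍ^d` with the norm `‖q‖ = (∑ |q_j|²)^{1/2}`. -/
abbrev QVec (d : ℕ) : Type := PiLp 2 (fun _ : Fin d => ℍ[ℝ])

/-- The quaternionic inner product `⟨a, z⟩ = a^* z`. -/
def qInner {d : ℕ} (a z : QVec d) : ℍ[ℝ] := ∑ j, star (a j) * z j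

/-- Right multiplication `x w` of a vector by a quaternion. -/
def rightMul {d : ℕ} (x : QVec d) (w : ℍ[ℝ]) : QVec d :=
  WithLp.toLp 2 fun j => x j * w

/-- `sign w = w / |w|` for `w ≠ 0`, and `sign 0 = 1`. -/
def qSign (w : ℍ[ℝ]) : ℍ[ℝ] :=
  open Classical in if w = 0 then 1 else ‖w‖⁻¹ • w

/-- Distance up to a right quaternion phase: the minimum over `|w| = 1` of `‖z - x w‖`. -/
def phaseDist {d : ℕ} (z x : QVec d) : ℝ :=
  ⨅ w : {w : ℍ[ℝ] // ‖w‖ = 1}, ‖z - rightMul x w.1‖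

/-- The phase `φ(z) = sign (x^* z)` of `z` relative to `x`. -/
def phase {d : ℕ} (x z : QVec d) : ℍ[ℝ] := qSign (qInner x z)

/-- The local regularity condition `LRC(μ, lam, ρ)` of a vector field `G` around `x`. -/
def LRC {d : ℕ} (G : QVec d → QVec d) (x : QVec d) (μ lam ρ : ℝ) : Prop :=
  ∀ z : QVec d, ‖z - rightMul x (phase x z)‖ ≤ ρ * ‖x‖ →
    lam / 2 * phaseDist z x ^ 2 + μ / 2 * ‖G z‖ ^ 2
      ≤ (qInner (G z) (z - rightMul x (phase x z))).re

/-- The phaseless data `ψ_k = |α_k^* x|`. -/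
def amplitudes {d n : ℕ} (A : Fin n → QVec d) (x : QVec d) : Fin n → ℝ :=
  fun k => ‖qInner (A k) x‖

/-- The perturbation vector `ε = √σ ψ`. -/
def perturbation {n : ℕ} (σ : ℝ) (ψ : Fin n → ℝ) : Fin n → ℝ := fun k => √σ * ψ k

/-- The perturbed amplitude objective `f_ε`. -/
def loss {d n : ℕ} (A : Fin n → QVec d) (ψ ε : Fin n → ℝ) (z : QVec d) : ℝ :=
  (1 / (n : ℝ)) * ∑ k, (√(‖qInner (A k) z‖ ^ 2 + ε k ^ 2) - √(ψ k ^ 2 + ε k ^ 2)) ^ 2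

/-- The imaginary unit `i`. -/
def unitI : ℍ[ℝ] := ⟨0, 1, 0, 0⟩

/-- The imaginary unit `j`. -/
def unitJ : ℍ[ℝ] := ⟨0, 0, 1, 0⟩

/-- The imaginary unit `k`. -/
def unitK : ℍ[ℝ] := ⟨0, 0, 0, 1⟩

/-- The partial derivative of `f` at `z` along the real coordinate `u ∈ {1, i, j, k}` of the
`l`-th quaternionic entry. -/
def partialDeriv {d : ℕ} (f : QVec d → ℝ) (z : QVec d) (l : Fin d) (u : ℍ[ℝ]) : ℝ :=
  lineDeriv ℝ f z (WithLp.toLp 2 (Pi.single l u))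

/-- The left generalized `ℍℝ` derivative with respect to the `l`-th entry. -/
def ghrDeriv {d : ℕ} (f : QVec d → ℝ) (z : QVec d) (l : Fin d) : ℍ[ℝ] :=
  (1 / 4 : ℝ) • (partialDeriv f z l 1 • (1 : ℍ[ℝ]) - partialDeriv f z l unitI • unitI
    - partialDeriv f z l unitJ • unitJ - partialDeriv f z l unitK • unitK)

/-- The generalized `ℍℝ` gradient: the conjugate transpose of the row of derivatives. -/
def ghrGradient {d : ℕ} (f : QVec d → ℝ) (z : QVec d) : QVec d :=
  WithLp.toLp 2 fun l => star (ghrDeriv f z l)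

/-- The search direction `∇f_ε(z)` used by the algorithm,
`(1/n) ∑ (1 - √(ψ_k² + ε_k²) / √(|α_k^* z|² + ε_k²)) α_k α_k^* z`. -/
def gradient {d n : ℕ} (A : Fin n → QVec d) (ψ ε : Fin n → ℝ) (z : QVec d) : QVec d :=
  (1 / (n : ℝ)) • ∑ k,
    (1 - √(ψ k ^ 2 + ε k ^ 2) / √(‖qInner (A k) z‖ ^ 2 + ε k ^ 2)) •
      rightMul (A k) (qInner (A k) z)

/-- The norm estimate `λ₀ = ((1/n) ∑ ψ_k²)^{1/2}`. -/
def normEstimate {n : ℕ} (ψ : Fin n → ℝ) : ℝ := √((1 / (n : ℝ)) * ∑ k, ψ k ^ 2)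

/-- The initialization matrix `S_in = (1/n) ∑ (γ - exp(-ψ_k²/λ₀²)) α_k α_k^*`. -/
def initMatrix {d n : ℕ} (A : Fin n → QVec d) (ψ : Fin n → ℝ) (γ : ℝ) :
    Matrix (Fin d) (Fin d) ℍ[ℝ] :=
  fun i j => (1 / (n : ℝ)) • ∑ k,
    (γ - Real.exp (-(ψ k ^ 2 / normEstimate ψ ^ 2))) • (A k i * star (A k j))

/-- `S v = v q` with `v ≠ 0`: `q` is a right eigenvalue with eigenvector `v`. -/
def IsRightEigenpair {d : ℕ} (S : Matrix (Fin d) (Fin d) ℍ[ℝ]) (q : ℍ[ℝ]) (v : QVec d) : Prop :=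
  v ≠ 0 ∧ ∀ i, ∑ j, S i j * v j = v i * q

/-- Standard eigenvalues are the right eigenvalues of the form `a + b i` with `b ≥ 0`. -/
def IsStandardEigenvalue {d : ℕ} (S : Matrix (Fin d) (Fin d) ℍ[ℝ]) (q : ℍ[ℝ]) : Prop :=
  (∃ v, IsRightEigenpair S q v) ∧ 0 ≤ q.imI ∧ q.imJ = 0 ∧ q.imK = 0

/-- `v` is a normalized eigenvector for the largest standard eigenvalue of the (Hermitian)
matrix `S`; the standard eigenvalues of a Hermitian matrix are real. -/
def IsLeadingEigenvector {d : ℕ} (S : Matrix (Fin d) (Fin d) ℍ[ℝ]) (v : QVec d) : Prop :=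
  ‖v‖ = 1 ∧ ∃ m : ℝ, IsRightEigenpair S (m : ℍ[ℝ]) v ∧
    ∀ q : ℍ[ℝ], IsStandardEigenvalue S q → q.re ≤ m

/-- The QPAF iteration `z_{t+1} = z_t - η ∇f_ε(z_t)` with `ε = √σ ψ`, started at `z0`. -/
def iterates {d n : ℕ} (A : Fin n → QVec d) (ψ : Fin n → ℝ) (σ η : ℝ) (z0 : QVec d) :
    ℕ → QVec d
  | 0 => z0
  | t + 1 => iterates A ψ σ η z0 t
      - η • gradient A ψ (perturbation σ ψ) (iterates A ψ σ η z0 t)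

/-- The four real coordinates of a quaternion. -/
def coords (q : ℍ[ℝ]) : Fin 4 → ℝ := ![q.re, q.imI, q.imJ, q.imK]

/-- The entries of the random vectors `α_k` are i.i.d. with law
`½ (N(0,1) + N(0,1) i + N(0,1) j + N(0,1) k)`: all real coordinates of all entries are
independent, each with law `½ N(0,1) = N(0, 1/4)`. -/
structure IsQuaternionGaussian {Ω : Type*} [MeasurableSpace Ω] {d n : ℕ} (P : Measure Ω)
    (α : Fin n → Ω → QVec d) : Prop where
  law : ∀ k j c, HasLaw (fun ω => coords (α k ω j) c) (gaussianReal 0 (1 / 4)) P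
  indep : iIndepFun (fun (p : Fin n × Fin d × Fin 4) ω => coords (α p.1 ω p.2.1) p.2.2) P

end QPAF

end

noncomputable section

namespace QPAF

/-! ### The quaternionic inner product -/

section InnerProduct

variable {d : ℕ}

/-! Everything is done in the real inner product Re(a^*z). The phase φ(z) attains the distance
(`phaseDist_eq`), so with h = z - xφ(z) and G = ∇f_ε(z), a step satisfies dist² ≤ ‖h‖² - 2η⟨G,h⟩ +
η²‖G‖². The regularity condition turns this into a contraction, and the convergence statement needs
only that condition and a good initial guess.

Local regularity is a deterministic consequence of four empirical bounds (`lrc_of_bounds`). Put u =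
α_k^*xφ and v = α_k^*h. When |v| ≤ δ|u|, the k-th summand of ⟨G,h⟩ is at least (⟨u,v⟩/|u|)²/(4+σ) up
to an error of order (δ/σ)|v|²; in every case it is at least -|v|² (`weight_mul_inner_ge`). For z
near the orbit of x, a summand with |v| > δ|u| has |u| small compared with ‖x‖ or |v| large compared
with ‖h‖, and both families carry little of the mass of ∑|v|². The main term is bounded below
because, after undoing the phase, x^*h is real. This excludes the directions xp with p imaginary,
along which ⟨u,v⟩ vanishes; on the remaining directions the expectation is at least ‖h‖²/4
(`integral_curvature_ge`).

For the initial guess let e = x/‖x‖. The mean of e^{-|α^*e|²}|α^*h|² over unit h is q - κ|e^*h|²,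
with κ > 0 (`spectralGap_pos`). The quadratic form of S_in is therefore close to γ - q + κ|e^*h|²,
and comparing Rayleigh quotients at ν and e forces |e^*ν| to be near 1 (`phaseDist_initial_le`).

The five empirical quantities involved all have the form (1/n)∑ G(α_k,h)² with 0 ≤ G(a,h) ≤ |a^*h|
and |G(a,h) - G(a,y)| ≤ |a^*(h-y)|. One uniform law of large numbers covers them
(`exists_uniform_concentration`): a Chernoff bound at each point of a net with e^{O(d)} points, paid
for by n ≥ Cd, and a passage to all h controlled by the Gram form. Since x is fixed, only uniformity
in h is needed; a cutoff depending on a^*x need not be smoothed. -/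

theorem re_qInner (a z : QVec d) : (qInner a z).re = inner ℝ a z := by
  rw [PiLp.inner_apply, qInner]
  rw [show (∑ j, star (a j) * z j).re = ∑ j, (star (a j) * z j).re from
    map_sum (QuaternionAlgebra.reₗ (-1 : ℝ) 0 (-1)) _ _]
  refine Finset.sum_congr rfl fun j _ => ?_
  simp only [Quaternion.inner_def, Quaternion.re_mul, Quaternion.re_star, Quaternion.imI_star,
    Quaternion.imJ_star, Quaternion.imK_star]
  ring

theorem qInner_add_right (a y z : QVec d) : qInner a (y + z) = qInner a y + qInner a z := by
  simp [qInner, mul_add, Finset.sum_add_distrib]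

theorem qInner_sub_right (a y z : QVec d) : qInner a (y - z) = qInner a y - qInner a z := by
  simp [qInner, mul_sub, Finset.sum_sub_distrib]

theorem qInner_smul_right (a z : QVec d) (r : ℝ) : qInner a (r • z) = r • qInner a z := by
  simp [qInner, Finset.smul_sum]

theorem qInner_zero_right (a : QVec d) : qInner a 0 = 0 := by
  simp [qInner]

theorem qInner_add_left (y z a : QVec d) : qInner (y + z) a = qInner y a + qInner z a := by
  simp [qInner, add_mul, Finset.sum_add_distrib]

theorem qInner_smul_left (a z : QVec d) (r : ℝ) : qInner (r • a) z = r • qInner a z := by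
  simp [qInner, Finset.smul_sum]

theorem qInner_rightMul_right (a z : QVec d) (w : ℍ[ℝ]) :
    qInner a (rightMul z w) = qInner a z * w := by
  simp [qInner, rightMul, Finset.sum_mul, mul_assoc]

theorem qInner_rightMul_left (a z : QVec d) (w : ℍ[ℝ]) :
    qInner (rightMul a w) z = star w * qInner a z := by
  simp [qInner, rightMul, Finset.mul_sum, mul_assoc]

theorem qInner_self (z : QVec d) : qInner z z = ((‖z‖ ^ 2 : ℝ) : ℍ[ℝ]) := by
  rw [PiLp.norm_sq_eq_of_L2, qInner]
  have : ∀ j, star (z j) * z j = ((‖z j‖ ^ 2 : ℝ) : ℍ[ℝ]) := fun j => by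
    rw [Quaternion.star_mul_self, Quaternion.normSq_eq_norm_mul_self, sq]
  simp only [this]
  exact (map_sum (algebraMap ℝ ℍ[ℝ]) _ _).symm

theorem norm_rightMul (x : QVec d) (w : ℍ[ℝ]) : ‖rightMul x w‖ = ‖x‖ * ‖w‖ := by
  have h : ‖rightMul x w‖ ^ 2 = (‖x‖ * ‖w‖) ^ 2 := by
    simp [PiLp.norm_sq_eq_of_L2, rightMul, mul_pow, Finset.sum_mul]
  exact (pow_left_inj₀ (norm_nonneg _) (by positivity) two_ne_zero).1 h

theorem rightMul_one (x : QVec d) : rightMul x 1 = x := by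
  refine PiLp.ext fun j => ?_; simp [rightMul]

theorem rightMul_mul (x : QVec d) (v w : ℍ[ℝ]) :
    rightMul (rightMul x v) w = rightMul x (v * w) := by
  refine PiLp.ext fun j => ?_; simp [rightMul, mul_assoc]

theorem rightMul_sub (x y : QVec d) (w : ℍ[ℝ]) :
    rightMul (x - y) w = rightMul x w - rightMul y w := by
  refine PiLp.ext fun j => ?_; simp [rightMul, sub_mul]

theorem real_inner_rightMul_left (a z : QVec d) (w : ℍ[ℝ]) :
    inner ℝ (rightMul a w) z = (star w * qInner a z).re := by
  rw [← re_qInner, qInner_rightMul_left]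

theorem abs_re_le_norm (q : ℍ[ℝ]) : |q.re| ≤ ‖q‖ := by
  have h : q.re ^ 2 ≤ ‖q‖ ^ 2 := by
    rw [sq ‖q‖, ← Quaternion.normSq_eq_norm_mul_self, Quaternion.normSq_def']
    nlinarith [sq_nonneg q.imI, sq_nonneg q.imJ, sq_nonneg q.imK]
  exact abs_le_of_sq_le_sq h (norm_nonneg _)

/-- Real Cauchy–Schwarz for a and z rotated by the conjugate of a^*z, whose real inner product is
|a^*z|². -/
theorem norm_qInner_le (a z : QVec d) : ‖qInner a z‖ ≤ ‖a‖ * ‖z‖ := by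
  have h : ‖qInner a z‖ ^ 2 ≤ ‖a‖ * (‖z‖ * ‖qInner a z‖) := by
    have h1 : inner ℝ a (rightMul z (star (qInner a z))) = ‖qInner a z‖ ^ 2 := by
      rw [← re_qInner, qInner_rightMul_right, Quaternion.self_mul_star, Quaternion.re_coe,
        Quaternion.normSq_eq_norm_mul_self, sq]
    rw [← h1, ← norm_star (qInner a z), ← norm_rightMul, h1]
    exact h1.symm.le.trans (real_inner_le_norm _ _)
  rcases (norm_nonneg (qInner a z)).eq_or_lt with h0 | h0
  · rw [← h0]; positivity
  · nlinarith

/-- `z ↦ a^* z` as a continuous real-linear map. -/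
def qInnerCLM (a : QVec d) : QVec d →L[ℝ] ℍ[ℝ] :=
  LinearMap.mkContinuous
    { toFun := qInner a
      map_add' := qInner_add_right a
      map_smul' := fun r z => qInner_smul_right a z r } ‖a‖ (norm_qInner_le a)

@[simp] theorem qInnerCLM_apply (a z : QVec d) : qInnerCLM a z = qInner a z := rfl

/-- `a ↦ a^* z` as a continuous real-linear map. -/
def qInnerFlipCLM (z : QVec d) : QVec d →L[ℝ] ℍ[ℝ] :=
  LinearMap.mkContinuous
    { toFun := fun a => qInner a z
      map_add' := fun a b => qInner_add_left a b z
      map_smul' := fun r a => qInner_smul_left a z r } ‖z‖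
    (fun a => (norm_qInner_le a z).trans (mul_comm _ _).le)

theorem norm_qSign (w : ℍ[ℝ]) : ‖qSign w‖ = 1 := by
  unfold qSign
  split_ifs with h
  · simp
  · rw [norm_smul, norm_inv, norm_norm, inv_mul_cancel₀ (norm_ne_zero_iff.2 h)]

theorem star_qSign_mul (w : ℍ[ℝ]) : star (qSign w) * w = (‖w‖ : ℍ[ℝ]) := by
  unfold qSign
  split_ifs with h
  · simp [h]
  · rw [Quaternion.star_smul, smul_mul_assoc, Quaternion.star_mul_self, Quaternion.normSq_eq_norm_mul_self]
    have := norm_ne_zero_iff.2 h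
    rw [← Quaternion.coe_smul, smul_eq_mul, inv_mul_cancel_left₀ this]

theorem norm_phase (x z : QVec d) : ‖phase x z‖ = 1 := norm_qSign _

theorem norm_sub_rightMul_sq (z x : QVec d) {w : ℍ[ℝ]} (hw : ‖w‖ = 1) :
    ‖z - rightMul x w‖ ^ 2 = ‖z‖ ^ 2 + ‖x‖ ^ 2 - 2 * (star w * qInner x z).re := by
  rw [norm_sub_sq_real, norm_rightMul, hw, real_inner_comm, real_inner_rightMul_left]
  ring

/-- The phase `φ(z)` attains the minimum in the definition of the distance. -/
theorem phaseDist_eq (z x : QVec d) : phaseDist z x = ‖z - rightMul x (phase x z)‖ := by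
  refine le_antisymm ?_ ?_
  · exact ciInf_le (f := fun w : {w : ℍ[ℝ] // ‖w‖ = 1} => ‖z - rightMul x w.1‖)
      ⟨0, by rintro _ ⟨w, rfl⟩; exact norm_nonneg _⟩ ⟨phase x z, norm_phase x z⟩
  · have : Nonempty {w : ℍ[ℝ] // ‖w‖ = 1} := ⟨⟨1, norm_one⟩⟩
    refine le_ciInf fun w => ?_
    -- After squaring, minimising the distance means maximising Re(w̄ x^*z), which is at most |x^*z|
    -- and equals it at the phase.
    refine (pow_le_pow_iff_left₀ (norm_nonneg _) (norm_nonneg _) two_ne_zero).1 ?_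
    rw [norm_sub_rightMul_sq _ _ w.2, norm_sub_rightMul_sq _ _ (norm_phase x z), phase,
      star_qSign_mul, Quaternion.re_coe]
    have := (le_abs_self _).trans (abs_re_le_norm (star w.1 * qInner x z))
    rw [norm_mul, norm_star, w.2, one_mul] at this
    linarith

theorem phaseDist_nonneg (z x : QVec d) : 0 ≤ phaseDist z x := by
  rw [phaseDist_eq]; exact norm_nonneg _

theorem phaseDist_le (z x : QVec d) {w : ℍ[ℝ]} (hw : ‖w‖ = 1) :
    phaseDist z x ≤ ‖z - rightMul x w‖ :=
  ciInf_le (f := fun w : {w : ℍ[ℝ] // ‖w‖ = 1} => ‖z - rightMul x w.1‖)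
    ⟨0, by rintro _ ⟨w, rfl⟩; exact norm_nonneg _⟩ ⟨w, hw⟩

theorem phaseDist_sq (z x : QVec d) :
    phaseDist z x ^ 2 = ‖z‖ ^ 2 + ‖x‖ ^ 2 - 2 * ‖qInner x z‖ := by
  rw [phaseDist_eq, norm_sub_rightMul_sq _ _ (norm_phase x z), phase, star_qSign_mul,
    Quaternion.re_coe]

end InnerProduct

/-! ### Linear convergence from local regularity -/

section Convergence

variable {d : ℕ}

/-- The new distance is bounded using the old phase. In the expanded square, the part -ημ‖G‖²
supplied by the regularity condition absorbs η²‖G‖² because η ≤ μ. -/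
theorem phaseDist_step_sq_le {G : QVec d → QVec d} {x : QVec d} {μ lam ρ : ℝ}
    (hG : LRC G x μ lam ρ) {η : ℝ} (hη : 0 < η) (hημ : η ≤ μ) {z : QVec d}
    (hz : phaseDist z x ≤ ρ * ‖x‖) :
    phaseDist (z - η • G z) x ^ 2 ≤ (1 - lam * η) * phaseDist z x ^ 2 := by
  have h := hG z (by rwa [← phaseDist_eq])
  rw [re_qInner] at h
  have h1 := pow_le_pow_left₀ (phaseDist_nonneg _ _)
    (phaseDist_le (z - η • G z) x (norm_phase x z)) 2
  have h2 : z - η • G z - rightMul x (phase x z) = (z - rightMul x (phase x z)) - η • G z := by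
    abel
  rw [h2, norm_sub_sq_real, inner_smul_right, real_inner_comm, norm_smul, mul_pow,
    Real.norm_eq_abs, sq_abs, ← phaseDist_eq] at h1
  nlinarith [mul_nonneg hη.le (sub_nonneg.2 h), mul_nonneg (mul_nonneg hη.le (sub_nonneg.2 hημ))
    (sq_nonneg ‖G z‖)]

theorem phaseDist_iterates_sq_le {n : ℕ} {A : Fin n → QVec d} {ψ : Fin n → ℝ} {σ : ℝ}
    {x : QVec d} {μ lam ρ : ℝ} (hlam : 0 < lam) (hlm : lam * μ < 1)
    (hG : LRC (gradient A ψ (perturbation σ ψ)) x μ lam ρ) {η : ℝ} (hη : 0 < η) (hημ : η ≤ μ)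
    {z₀ : QVec d} (hz : phaseDist z₀ x ≤ ρ * ‖x‖) (t : ℕ) :
    phaseDist (iterates A ψ σ η z₀ t) x ^ 2 ≤ (1 - lam * η) ^ t * phaseDist z₀ x ^ 2 := by
  have hc0 : 0 ≤ 1 - lam * η := by nlinarith
  have hc1 : 1 - lam * η ≤ 1 := by nlinarith
  induction t with
  | zero => simp [iterates]
  | succ t ih =>
    -- The distance has not grown, so the iterate is still in the region where the regularity
    -- condition applies.
    have hle : phaseDist (iterates A ψ σ η z₀ t) x ≤ phaseDist z₀ x := by
      refine (pow_le_pow_iff_left₀ (phaseDist_nonneg _ _) (phaseDist_nonneg _ _) two_ne_zero).1 ?_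
      exact ih.trans (mul_le_of_le_one_left (sq_nonneg _) (pow_le_one₀ hc0 hc1))
    calc _ ≤ (1 - lam * η) * phaseDist (iterates A ψ σ η z₀ t) x ^ 2 :=
          phaseDist_step_sq_le hG hη hημ (hle.trans hz)
      _ ≤ (1 - lam * η) * ((1 - lam * η) ^ t * phaseDist z₀ x ^ 2) := by gcongr
      _ = _ := by ring

end Convergence

/-! ### The search direction as a gradient -/

section Gradient

variable {d n : ℕ}

theorem real_inner_gradient (A : Fin n → QVec d) (ψ ε : Fin n → ℝ) (z y : QVec d) :
    inner ℝ (gradient A ψ ε z) y = (1 / (n : ℝ)) * ∑ k,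
      (1 - √(ψ k ^ 2 + ε k ^ 2) / √(‖qInner (A k) z‖ ^ 2 + ε k ^ 2)) *
        inner ℝ (qInner (A k) z) (qInner (A k) y) := by
  rw [gradient, real_inner_smul_left, sum_inner]
  congr 1
  refine Finset.sum_congr rfl fun k _ => ?_
  rw [real_inner_smul_left, real_inner_rightMul_left, real_inner_comm, Quaternion.inner_def]
  congr 1
  simp only [Quaternion.re_mul, Quaternion.re_star, Quaternion.imI_star,
    Quaternion.imJ_star, Quaternion.imK_star]
  ring

/-- For e = 0 the square root may be singular where L z = 0, but then c = 0 and the function is just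
‖L z‖². The convention 0/0 = 0 agrees with reading the weight of such a summand as 1. -/
theorem hasFDerivAt_sqrt_norm_sq_add_sub_sq {E F : Type*} [NormedAddCommGroup E]
    [NormedSpace ℝ E] [NormedAddCommGroup F] [InnerProductSpace ℝ F] (L : E →L[ℝ] F) {e c : ℝ}
    (h : e = 0 → c = 0) (z : E) :
    HasFDerivAt (fun z => (√(‖L z‖ ^ 2 + e ^ 2) - c) ^ 2)
      ((2 * (1 - c / √(‖L z‖ ^ 2 + e ^ 2))) • (innerSL ℝ (L z)).comp L) z := by
  have hn : HasFDerivAt (fun z => ‖L z‖ ^ 2) ((2 : ℝ) • (innerSL ℝ (L z)).comp L) z := by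
    have := (L.hasFDerivAt (x := z)).norm_sq
    simpa [two_smul] using this
  by_cases he : e = 0
  · simp only [he, h he, sub_zero, zero_div, mul_one, ne_eq, OfNat.ofNat_ne_zero,
      not_false_eq_true, zero_pow, add_zero, Real.sqrt_sq (norm_nonneg _)]
    exact hn
  · have hpos : 0 < ‖L z‖ ^ 2 + e ^ 2 := by positivity
    have hs := (((hn.add_const (e ^ 2)).sqrt hpos.ne').sub_const c).pow 2
    refine hs.congr_fderiv ?_
    have hne : √(‖L z‖ ^ 2 + e ^ 2) ≠ 0 := (Real.sqrt_pos.2 hpos).ne'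
    rw [smul_smul, smul_smul]
    congr 1
    simp
    field_simp

theorem hasFDerivAt_loss (A : Fin n → QVec d) {ψ ε : Fin n → ℝ}
    (h : ∀ k, ε k = 0 → ψ k = 0) (z : QVec d) :
    HasFDerivAt (loss A ψ ε) ((2 : ℝ) • innerSL ℝ (gradient A ψ ε z)) z := by
  have hk : ∀ k ∈ Finset.univ, HasFDerivAt
      (fun z => (√(‖qInner (A k) z‖ ^ 2 + ε k ^ 2) - √(ψ k ^ 2 + ε k ^ 2)) ^ 2)
      ((2 * (1 - √(ψ k ^ 2 + ε k ^ 2) / √(‖qInner (A k) z‖ ^ 2 + ε k ^ 2))) •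
        (innerSL ℝ (qInner (A k) z)).comp (qInnerCLM (A k))) z := fun k _ =>
    hasFDerivAt_sqrt_norm_sq_add_sub_sq (qInnerCLM (A k)) (fun h0 => by simp [h0, h k h0]) z
  refine ((HasFDerivAt.fun_sum hk).const_mul (1 / (n : ℝ))).congr_fderiv ?_
  ext y
  simp only [smul_apply, sum_apply,
    ContinuousLinearMap.comp_apply, innerSL_apply_apply, qInnerCLM_apply, smul_eq_mul,
    real_inner_gradient, Finset.mul_sum]
  refine Finset.sum_congr rfl fun k _ => ?_
  ring

/-- The derivative of the loss is 2⟨∇f_ε, ·⟩, so each partial derivative is twice a real coordinate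
of the search direction; the factor 1/4 leaves one half. Conjugation undoes the minus signs of the
derivative row. -/
theorem gradient_eq_two_smul_ghrGradient (A : Fin n → QVec d) {ψ ε : Fin n → ℝ}
    (h : ∀ k, ε k = 0 → ψ k = 0) (z : QVec d) :
    gradient A ψ ε z = (2 : ℝ) • ghrGradient (loss A ψ ε) z := by
  have hp : ∀ l u, partialDeriv (loss A ψ ε) z l u = 2 * inner ℝ (gradient A ψ ε z l) u := by
    intro l u
    rw [partialDeriv, ((hasFDerivAt_loss A h z).hasLineDerivAt _).lineDeriv]
    simp only [smul_apply, innerSL_apply_apply, smul_eq_mul]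
    congr 1
    rw [PiLp.inner_apply, Finset.sum_eq_single l]
    · simp
    · intro j _ hj
      simp [hj]
    · simp
  refine PiLp.ext fun l => ?_
  simp only [ghrGradient, ghrDeriv, hp, PiLp.smul_apply]
  have h1 : ∀ q : ℍ[ℝ], inner ℝ q 1 = q.re := fun q => by simp [Quaternion.inner_def]
  have hI : ∀ q : ℍ[ℝ], inner ℝ q unitI = q.imI := fun q => by
    simp [Quaternion.inner_def, Quaternion.re_mul, show unitI.re = 0 from rfl,
      show unitI.imI = 1 from rfl, show unitI.imJ = 0 from rfl, show unitI.imK = 0 from rfl]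
  have hJ : ∀ q : ℍ[ℝ], inner ℝ q unitJ = q.imJ := fun q => by
    simp [Quaternion.inner_def, Quaternion.re_mul, show unitJ.re = 0 from rfl,
      show unitJ.imI = 0 from rfl, show unitJ.imJ = 1 from rfl, show unitJ.imK = 0 from rfl]
  have hK : ∀ q : ℍ[ℝ], inner ℝ q unitK = q.imK := fun q => by
    simp [Quaternion.inner_def, Quaternion.re_mul, show unitK.re = 0 from rfl,
      show unitK.imI = 0 from rfl, show unitK.imJ = 0 from rfl, show unitK.imK = 1 from rfl]
  simp only [h1, hI, hJ, hK]
  ext <;> simp [show unitI.re = 0 from rfl,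
      show unitI.imI = 1 from rfl, show unitI.imJ = 0 from rfl, show unitI.imK = 0 from rfl,
      show unitJ.re = 0 from rfl,
      show unitJ.imI = 0 from rfl, show unitJ.imJ = 1 from rfl, show unitJ.imK = 0 from rfl,
      show unitK.re = 0 from rfl,
      show unitK.imI = 0 from rfl, show unitK.imJ = 0 from rfl, show unitK.imK = 1 from rfl] <;>
    ring

theorem perturbation_eq_zero {σ : ℝ} (hσ : 0 < σ) (ψ : Fin n → ℝ) (k : Fin n)
    (h : perturbation σ ψ k = 0) : ψ k = 0 := by
  rcases mul_eq_zero.1 h with h | h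
  · exact absurd h (Real.sqrt_pos.2 hσ).ne'
  · exact h

end Gradient

/-! ### Local regularity -/

section LocalRegularity

/-- The weight of the `k`-th summand of the search direction at `z`, in terms of
`u = α_k^* x` and `w = α_k^* z`. -/
def weight (σ : ℝ) (u w : ℍ[ℝ]) : ℝ :=
  1 - √(‖u‖ ^ 2 + (√σ * ‖u‖) ^ 2) / √(‖w‖ ^ 2 + (√σ * ‖u‖) ^ 2)

theorem abs_sqrt_sq_add_sub_le {a b e : ℝ} (ha : 0 ≤ a) (hb : 0 ≤ b) :
    |√(a ^ 2 + e ^ 2) - √(b ^ 2 + e ^ 2)| ≤ |a - b| := by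
  have key : ∀ {a b : ℝ}, 0 ≤ a → 0 ≤ b → b ≤ a →
      √(a ^ 2 + e ^ 2) ≤ √(b ^ 2 + e ^ 2) + (a - b) := by
    intro a b ha hb hab
    refine Real.sqrt_le_iff.2 ⟨by have := Real.sqrt_nonneg (b ^ 2 + e ^ 2); linarith, ?_⟩
    have h1 : b ≤ √(b ^ 2 + e ^ 2) := Real.le_sqrt_of_sq_le (by nlinarith [sq_nonneg e])
    have h2 := Real.sq_sqrt (show 0 ≤ b ^ 2 + e ^ 2 by positivity)
    nlinarith [mul_nonneg (sub_nonneg.2 hab) (sub_nonneg.2 h1)]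
  rcases le_total b a with h | h
  · have h3 : √(b ^ 2 + e ^ 2) ≤ √(a ^ 2 + e ^ 2) := Real.sqrt_le_sqrt (by nlinarith)
    rw [abs_of_nonneg (sub_nonneg.2 h3), abs_of_nonneg (sub_nonneg.2 h)]
    linarith [key ha hb h]
  · have h3 : √(a ^ 2 + e ^ 2) ≤ √(b ^ 2 + e ^ 2) := Real.sqrt_le_sqrt (by nlinarith)
    rw [abs_sub_comm, abs_of_nonneg (sub_nonneg.2 h3), abs_sub_comm a,
      abs_of_nonneg (sub_nonneg.2 h)]
    linarith [key hb ha h]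

/-- Over the common denominator B the weight is a difference of values of the 1-Lipschitz function t
↦ √(t²+ε²), and |w| ≤ B cancels the denominator. No smallness is needed, so it serves both for
‖∇f_ε‖ and for the bad summands. -/
theorem abs_weight_mul_norm_le (σ : ℝ) (u w : ℍ[ℝ]) :
    |weight σ u w| * ‖w‖ ≤ ‖w - u‖ := by
  have h1 := abs_sqrt_sq_add_sub_le (e := √σ * ‖u‖) (norm_nonneg w) (norm_nonneg u)
  have h2 := abs_norm_sub_norm_le w u
  unfold weight
  set B := √(‖w‖ ^ 2 + (√σ * ‖u‖) ^ 2) with hB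
  have hwB : ‖w‖ ≤ B := Real.le_sqrt_of_sq_le (by nlinarith [sq_nonneg (√σ * ‖u‖)])
  rcases (Real.sqrt_nonneg (‖w‖ ^ 2 + (√σ * ‖u‖) ^ 2)).eq_or_lt with h0 | h0
  · have : ‖w‖ = 0 := le_antisymm (hwB.trans (hB.trans h0.symm).le) (norm_nonneg _)
    rw [this, mul_zero]; exact norm_nonneg _
  · rw [← hB] at h0
    rw [one_sub_div h0.ne', abs_div, abs_of_pos h0, div_mul_eq_mul_div, div_le_iff₀ h0]
    exact mul_le_mul (h1.trans h2) hwB (norm_nonneg _) (norm_nonneg _)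

theorem neg_sq_le_weight_mul_inner (σ : ℝ) (u v : ℍ[ℝ]) :
    -‖v‖ ^ 2 ≤ weight σ u (u + v) * inner ℝ (u + v) v := by
  have h1 := abs_weight_mul_norm_le σ u (u + v)
  rw [add_sub_cancel_left] at h1
  have h2 := abs_real_inner_le_norm (u + v) v
  have h3 : |weight σ u (u + v) * inner ℝ (u + v) v| ≤ ‖v‖ ^ 2 := by
    rw [abs_mul]
    calc _ ≤ |weight σ u (u + v)| * (‖u + v‖ * ‖v‖) := by gcongr
      _ = |weight σ u (u + v)| * ‖u + v‖ * ‖v‖ := by ring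
      _ ≤ ‖v‖ * ‖v‖ := by gcongr
      _ = _ := by ring
  exact (abs_le.1 h3).1

theorem sq_inner_div_norm_le (u v : ℍ[ℝ]) : (inner ℝ u v / ‖u‖) ^ 2 ≤ ‖v‖ ^ 2 := by
  rw [sq_le_sq, abs_div, abs_norm, abs_norm]
  rcases (norm_nonneg u).eq_or_lt with h | h
  · simp [← h]
  · rw [div_le_iff₀ h, mul_comm]; exact abs_real_inner_le_norm u v

/-- Here s = |u|, t = |v|, r = ⟨u,v⟩. Rationalising gives 1 - a/b = (2r+t²)/(b²+ab). The numerator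
(2r+t²)(r+t²) is at least 2r² - 3|r|t², and the denominator lies between σs² (used for the error)
and 2(4+σ)s² (used for the main term). -/
theorem one_sub_div_mul_ge {σ δ r s t a b : ℝ} (hσ : 0 < σ) (hδ0 : 0 ≤ δ) (hs : 0 < s)
    (ht0 : 0 ≤ t) (hts : t ≤ s) (htδ : t ≤ δ * s) (hrt : |r| ≤ s * t) (ha0 : 0 < a) (hb0 : 0 < b)
    (ha2 : a ^ 2 = (1 + σ) * s ^ 2) (hb2 : b ^ 2 = (1 + σ) * s ^ 2 + (2 * r + t ^ 2))
    (hblow : σ * s ^ 2 ≤ b ^ 2) :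
    (r / s) ^ 2 / (4 + σ) - 3 * δ / σ * t ^ 2 ≤ (1 - a / b) * (r + t ^ 2) := by
  have hab : 0 < a * b := mul_pos ha0 hb0
  have hst : s * t ≤ s ^ 2 := by rw [sq]; gcongr
  have htt : t ^ 2 ≤ s ^ 2 := by gcongr
  have hr1 : r ≤ s ^ 2 := (le_abs_self r).trans (hrt.trans hst)
  have hD0 : σ * s ^ 2 ≤ b ^ 2 + a * b := by linarith
  have hb4 : b ^ 2 ≤ (4 + σ) * s ^ 2 := by rw [hb2]; linarith
  have ha4 : a ^ 2 ≤ (4 + σ) * s ^ 2 := by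
    rw [ha2]; gcongr; norm_num
  have hD1 : b ^ 2 + a * b ≤ 2 * ((4 + σ) * s ^ 2) := by
    have := two_mul_le_add_sq a b
    linarith
  have hDpos : 0 < b ^ 2 + a * b := by positivity
  have heq : (1 - a / b) * (r + t ^ 2) = (2 * r + t ^ 2) * (r + t ^ 2) / (b ^ 2 + a * b) := by
    have : 2 * r + t ^ 2 = b ^ 2 - a ^ 2 := by rw [ha2, hb2]; ring
    rw [this]; field_simp; ring
  have h1 : (r / s) ^ 2 / (4 + σ) ≤ 2 * r ^ 2 / (b ^ 2 + a * b) := by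
    rw [div_pow, div_div, div_le_div_iff₀ (by positivity) hDpos]
    have := mul_le_mul_of_nonneg_left hD1 (sq_nonneg r)
    linarith
  have h2 : 3 * |r| * t ^ 2 / (b ^ 2 + a * b) ≤ 3 * δ / σ * t ^ 2 := by
    have e1 : |r| ≤ δ * s ^ 2 := by
      calc |r| ≤ s * t := hrt
        _ ≤ s * (δ * s) := by gcongr
        _ = δ * s ^ 2 := by ring
    calc 3 * |r| * t ^ 2 / (b ^ 2 + a * b) ≤ 3 * (δ * s ^ 2) * t ^ 2 / (σ * s ^ 2) := by gcongr
      _ = _ := by field_simp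
  have h3 : 2 * r ^ 2 / (b ^ 2 + a * b) - 3 * |r| * t ^ 2 / (b ^ 2 + a * b)
      ≤ (2 * r + t ^ 2) * (r + t ^ 2) / (b ^ 2 + a * b) := by
    rw [← sub_div]
    refine div_le_div_of_nonneg_right ?_ hDpos.le
    have e1 := mul_le_mul_of_nonneg_right (neg_abs_le r) (sq_nonneg t)
    have e2 : (2 * r + t ^ 2) * (r + t ^ 2) = 2 * r ^ 2 + 3 * (r * t ^ 2) + (t ^ 2) ^ 2 := by ring
    have e3 := sq_nonneg (t ^ 2)
    rw [e2]
    linarith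
  rw [heq]
  linarith

theorem weight_mul_inner_ge_of_norm_le {σ δ : ℝ} (hσ : 0 < σ) (hδ0 : 0 ≤ δ) (hδ1 : δ ≤ 1)
    {u v : ℍ[ℝ]} (hv : ‖v‖ ≤ δ * ‖u‖) :
    (inner ℝ u v / ‖u‖) ^ 2 / (4 + σ) - 3 * δ / σ * ‖v‖ ^ 2
      ≤ weight σ u (u + v) * inner ℝ (u + v) v := by
  rcases (norm_nonneg u).eq_or_lt with hu | hu
  · have hv0 : v = 0 := norm_le_zero_iff.1 (hv.trans (by rw [← hu, mul_zero]))
    simp [hv0]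
  have hin : inner ℝ (u + v) v = inner ℝ u v + ‖v‖ ^ 2 := by
    rw [inner_add_left, real_inner_self_eq_norm_sq]
  have hB : ‖u + v‖ ^ 2 + (√σ * ‖u‖) ^ 2
      = (1 + σ) * ‖u‖ ^ 2 + (2 * inner ℝ u v + ‖v‖ ^ 2) := by
    rw [norm_add_sq_real, mul_pow, Real.sq_sqrt hσ.le]; ring
  have hA : ‖u‖ ^ 2 + (√σ * ‖u‖) ^ 2 = (1 + σ) * ‖u‖ ^ 2 := by
    rw [mul_pow, Real.sq_sqrt hσ.le]; ring
  have hBlow : σ * ‖u‖ ^ 2 ≤ ‖u + v‖ ^ 2 + (√σ * ‖u‖) ^ 2 := by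
    rw [mul_pow, Real.sq_sqrt hσ.le]; linarith [sq_nonneg ‖u + v‖]
  have hσs : 0 < σ * ‖u‖ ^ 2 := by positivity
  rw [weight, hin]
  exact one_sub_div_mul_ge hσ hδ0 hu (norm_nonneg v)
    (hv.trans (mul_le_of_le_one_left hu.le hδ1)) hv (abs_real_inner_le_norm u v)
    (Real.sqrt_pos.2 (by positivity)) (Real.sqrt_pos.2 (by linarith))
    ((Real.sq_sqrt (by positivity)).trans hA) ((Real.sq_sqrt (by positivity)).trans hB)
    (by rw [Real.sq_sqrt (by positivity)]; exact hBlow)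

/-- The coefficient 2 of the bad term pays once for the worst case -|v|² and once for the curvature
term, which is at most |v|² and is kept in every summand. -/
theorem weight_mul_inner_ge {σ δ : ℝ} (hσ : 0 < σ) (hδ0 : 0 ≤ δ) (hδ1 : δ ≤ 1) (u v : ℍ[ℝ]) :
    (inner ℝ u v / ‖u‖) ^ 2 / (4 + σ) - 3 * δ / σ * ‖v‖ ^ 2
        - 2 * (if δ * ‖u‖ < ‖v‖ then ‖v‖ ^ 2 else 0)
      ≤ weight σ u (u + v) * inner ℝ (u + v) v := by
  split_ifs with h
  · have h1 := neg_sq_le_weight_mul_inner σ u v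
    have h2 : (inner ℝ u v / ‖u‖) ^ 2 / (4 + σ) ≤ ‖v‖ ^ 2 :=
      (div_le_self (sq_nonneg _) (by linarith)).trans (sq_inner_div_norm_le u v)
    have h3 : 0 ≤ 3 * δ / σ * ‖v‖ ^ 2 := by positivity
    linarith
  · have := weight_mul_inner_ge_of_norm_le hσ hδ0 hδ1 (not_lt.1 h)
    linarith

theorem qSign_mul_norm (w : ℍ[ℝ]) : w * star (qSign w) = (‖w‖ : ℍ[ℝ]) := by
  have h := star_qSign_mul w
  have h1 : qSign w * star (qSign w) = 1 := by
    rw [Quaternion.self_mul_star, Quaternion.normSq_eq_norm_mul_self, norm_qSign]; simp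
  calc w * star (qSign w) = qSign w * star (qSign w) * w * star (qSign w) := by rw [h1, one_mul]
    _ = qSign w * (star (qSign w) * w) * star (qSign w) := by noncomm_ring
    _ = (‖w‖ : ℍ[ℝ]) * (qSign w * star (qSign w)) := by
      rw [h, ← Quaternion.coe_commutes, mul_assoc]
    _ = _ := by rw [h1, mul_one]

theorem real_inner_mul_left (u v w : ℍ[ℝ]) : inner ℝ (u * w) v = inner ℝ u (v * star w) := by
  rw [Quaternion.inner_def, Quaternion.inner_def, star_mul, star_star, mul_assoc]

variable {d n : ℕ}

/-- The deviation `z - x φ(z)` has real inner product with `x φ(z)`. -/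
theorem qInner_deviation_real (x z : QVec d) :
    ∃ r : ℝ, qInner x (rightMul (z - rightMul x (phase x z)) (star (phase x z))) = (r : ℍ[ℝ]) := by
  refine ⟨‖qInner x z‖ - ‖x‖ ^ 2, ?_⟩
  have h1 : phase x z * star (phase x z) = 1 := by
    rw [Quaternion.self_mul_star, Quaternion.normSq_eq_norm_mul_self, norm_phase]; simp
  rw [rightMul_sub, rightMul_mul, h1, rightMul_one, qInner_sub_right, qInner_rightMul_right,
    phase, qSign_mul_norm, qInner_self]
  norm_cast

/-- Sufficient conditions for the local regularity of the search direction. -/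
theorem lrc_of_bounds {σ δ τ T ρ ε : ℝ} (hσ : 0 < σ) (hδ0 : 0 < δ) (hδ1 : δ ≤ 1)
    (hδσ : 3 * δ / σ * 2 ≤ 1 / (64 * (4 + σ))) (hε : 2 * (ε + ε) ≤ 1 / (64 * (4 + σ)))
    (hT : 0 ≤ T) (hρ : T * ρ ≤ δ * τ) (A : Fin n → QVec d) (x : QVec d)
    (hM : ∀ h, (1 / (n : ℝ)) * ∑ k, ‖qInner (A k) h‖ ^ 2 ≤ 2 * ‖h‖ ^ 2)
    (hC : ∀ h, (∃ r : ℝ, qInner x h = (r : ℍ[ℝ])) → 1 / 8 * ‖h‖ ^ 2 ≤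
      (1 / (n : ℝ)) * ∑ k, (inner ℝ (qInner (A k) x) (qInner (A k) h) / ‖qInner (A k) x‖) ^ 2)
    (hB : ∀ h, (1 / (n : ℝ)) * ∑ k, (if ‖qInner (A k) x‖ < τ * ‖x‖ then
      ‖qInner (A k) h‖ ^ 2 else 0) ≤ ε * ‖h‖ ^ 2)
    (hA : ∀ h, (1 / (n : ℝ)) * ∑ k, (if T * ‖h‖ < ‖qInner (A k) h‖ then
      ‖qInner (A k) h‖ ^ 2 else 0) ≤ ε * ‖h‖ ^ 2) :
    LRC (gradient A (amplitudes A x) (perturbation σ (amplitudes A x))) x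
      (1 / (128 * (4 + σ))) (1 / (16 * (4 + σ))) ρ := by
  intro z hz
  rw [phaseDist_eq, re_qInner]
  set h := z - rightMul x (phase x z) with hh
  set G := gradient A (amplitudes A x) (perturbation σ (amplitudes A x)) z with hG
  have hn0 : (0 : ℝ) ≤ 1 / (n : ℝ) := by positivity
  -- the summands in terms of `u k = α_k^* x φ` and `v k = α_k^* h`
  set u : Fin n → ℍ[ℝ] := fun k => qInner (A k) x * phase x z with hu
  set v : Fin n → ℍ[ℝ] := fun k => qInner (A k) h with hv
  have huv : ∀ k, qInner (A k) z = u k + v k := fun k => by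
    simp only [hu, hv, hh, qInner_sub_right, qInner_rightMul_right]; abel
  have hun : ∀ k, ‖u k‖ = ‖qInner (A k) x‖ := fun k => by
    simp only [hu, norm_mul, norm_phase, mul_one]
  have hGy : ∀ y, inner ℝ G y = (1 / (n : ℝ)) * ∑ k,
      weight σ (u k) (u k + v k) * inner ℝ (u k + v k) (qInner (A k) y) := by
    intro y
    rw [hG, real_inner_gradient]
    simp only [weight, hun, ← huv, amplitudes, perturbation]
  have hMh := hM h
  -- bound on the norm of the search direction
  have hGn : ‖G‖ ^ 2 ≤ 4 * ‖h‖ ^ 2 := by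
    -- G is tested against itself: |v||α_k^*G| ≤ |v|² + |α_k^*G|²/4, and the Gram bound makes the
    -- mean of the last term at most ‖G‖²/2, which is absorbed on the left.
    have h1 : ∀ k, weight σ (u k) (u k + v k) * inner ℝ (u k + v k) (qInner (A k) G)
        ≤ ‖v k‖ ^ 2 + ‖qInner (A k) G‖ ^ 2 / 4 := fun k => by
      have e1 := abs_weight_mul_norm_le σ (u k) (u k + v k)
      rw [add_sub_cancel_left] at e1
      have e2 := abs_real_inner_le_norm (u k + v k) (qInner (A k) G)
      calc _ ≤ |weight σ (u k) (u k + v k) * inner ℝ (u k + v k) (qInner (A k) G)| :=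
            le_abs_self _
        _ ≤ |weight σ (u k) (u k + v k)| * (‖u k + v k‖ * ‖qInner (A k) G‖) := by
            rw [abs_mul]; gcongr
        _ = |weight σ (u k) (u k + v k)| * ‖u k + v k‖ * ‖qInner (A k) G‖ := by ring
        _ ≤ ‖v k‖ * ‖qInner (A k) G‖ := by gcongr
        _ ≤ _ := by nlinarith [sq_nonneg (‖v k‖ - ‖qInner (A k) G‖ / 2)]
    have h2 : inner ℝ G G ≤ (1 / (n : ℝ)) * ∑ k, (‖v k‖ ^ 2 + ‖qInner (A k) G‖ ^ 2 / 4) := by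
      rw [hGy G]
      exact mul_le_mul_of_nonneg_left (Finset.sum_le_sum fun k _ => h1 k) hn0
    rw [Finset.sum_add_distrib, mul_add, ← Finset.sum_div, mul_div_assoc',
      real_inner_self_eq_norm_sq] at h2
    have h3 := hM G
    simp only [hv] at h2
    linarith
  -- curvature
  have hcur : 1 / (16 * (4 + σ)) * ‖h‖ ^ 2 ≤ inner ℝ G h := by
    -- If neither exceptional case occurs, then |v| ≤ T‖h‖ ≤ Tρ‖x‖ ≤ δτ‖x‖ ≤ δ|u|.
    have hsplit : ∀ k, (if δ * ‖u k‖ < ‖v k‖ then ‖v k‖ ^ 2 else 0)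
        ≤ (if ‖qInner (A k) x‖ < τ * ‖x‖ then ‖qInner (A k) h‖ ^ 2 else 0)
          + (if T * ‖h‖ < ‖qInner (A k) h‖ then ‖qInner (A k) h‖ ^ 2 else 0) := by
      intro k
      have hnn := sq_nonneg ‖qInner (A k) h‖
      by_cases h1 : ‖qInner (A k) x‖ < τ * ‖x‖
      · simp only [h1, if_true, hv]; split_ifs <;> linarith
      · by_cases h2 : T * ‖h‖ < ‖qInner (A k) h‖
        · simp only [h2, if_true, hv]; split_ifs <;> linarith
        · have h3 : ¬ δ * ‖u k‖ < ‖v k‖ := by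
            rw [hun]
            push Not at h1 h2 ⊢
            calc ‖v k‖ ≤ T * ‖h‖ := h2
              _ ≤ T * (ρ * ‖x‖) := by gcongr
              _ = T * ρ * ‖x‖ := by ring
              _ ≤ δ * τ * ‖x‖ := by gcongr
              _ = δ * (τ * ‖x‖) := by ring
              _ ≤ _ := by gcongr
          simp [h1, h2, h3]
    have hterm : ∀ k, (inner ℝ (u k) (v k) / ‖u k‖) ^ 2 / (4 + σ) - 3 * δ / σ * ‖v k‖ ^ 2
        - 2 * ((if ‖qInner (A k) x‖ < τ * ‖x‖ then ‖qInner (A k) h‖ ^ 2 else 0)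
          + (if T * ‖h‖ < ‖qInner (A k) h‖ then ‖qInner (A k) h‖ ^ 2 else 0))
        ≤ weight σ (u k) (u k + v k) * inner ℝ (u k + v k) (qInner (A k) h) := fun k => by
      have := weight_mul_inner_ge hσ hδ0.le hδ1 (u k) (v k)
      have := hsplit k
      linarith
    have hsum := mul_le_mul_of_nonneg_left (Finset.sum_le_sum fun k (_ : k ∈ Finset.univ) =>
      hterm k) hn0
    rw [← hGy h, Finset.sum_sub_distrib, Finset.sum_sub_distrib, ← Finset.sum_div,
      ← Finset.mul_sum, ← Finset.mul_sum, Finset.sum_add_distrib] at hsum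
    -- Rotating h by the conjugate phase makes x^*h real and leaves norms and the products ⟨u,v⟩
    -- unchanged.
    have hCh : 1 / 8 * ‖h‖ ^ 2 ≤ (1 / (n : ℝ)) * ∑ k, (inner ℝ (u k) (v k) / ‖u k‖) ^ 2 := by
      have := hC (rightMul h (star (phase x z))) (qInner_deviation_real x z)
      rw [norm_rightMul, norm_star, norm_phase, mul_one] at this
      simpa only [qInner_rightMul_right, hu, hv, real_inner_mul_left, norm_mul, norm_phase,
        mul_one] using this
    have hBh := hB h
    have hAh := hA h
    have hσ4 : 0 < 4 + σ := by linarith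
    -- In units of ‖h‖²/(64(4+σ)): the curvature gives 8, the cubic error and the bad summands cost
    -- at most 1 each, and 4 is claimed.
    have e1 : 1 / 8 * ‖h‖ ^ 2 / (4 + σ)
        ≤ (1 / (n : ℝ)) * ((∑ k, (inner ℝ (u k) (v k) / ‖u k‖) ^ 2) / (4 + σ)) := by
      rw [mul_div_assoc']; gcongr
    have e2 : 3 * δ / σ * ((1 / (n : ℝ)) * ∑ k, ‖v k‖ ^ 2) ≤ 3 * δ / σ * (2 * ‖h‖ ^ 2) := by
      gcongr
    have e3 : 3 * δ / σ * (2 * ‖h‖ ^ 2) ≤ 1 / (64 * (4 + σ)) * ‖h‖ ^ 2 := by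
      rw [← mul_assoc]; gcongr
    have e4 : 2 * (ε + ε) * ‖h‖ ^ 2 ≤ 1 / (64 * (4 + σ)) * ‖h‖ ^ 2 := by gcongr
    have e5 : 1 / 8 * ‖h‖ ^ 2 / (4 + σ) = 8 * (1 / (64 * (4 + σ)) * ‖h‖ ^ 2) := by
      field_simp; ring
    have e6 : 1 / (16 * (4 + σ)) * ‖h‖ ^ 2 = 4 * (1 / (64 * (4 + σ)) * ‖h‖ ^ 2) := by
      field_simp; ring
    have e7 : 0 ≤ 1 / (64 * (4 + σ)) * ‖h‖ ^ 2 := by positivity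
    rw [e6]
    linarith
  -- In the same units the condition asks for 2 from the distance and at most 1 from ‖G‖² ≤ 4‖h‖²,
  -- out of the available 4.
  have f1 : 1 / (128 * (4 + σ)) / 2 * ‖G‖ ^ 2 ≤ 1 / (128 * (4 + σ)) / 2 * (4 * ‖h‖ ^ 2) := by
    gcongr
  have f2 : 1 / (128 * (4 + σ)) / 2 * (4 * ‖h‖ ^ 2) = 1 / 4 * (1 / (16 * (4 + σ)) * ‖h‖ ^ 2) := by
    field_simp; ring
  have f3 : 0 ≤ 1 / (16 * (4 + σ)) * ‖h‖ ^ 2 := by positivity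
  linarith

end LocalRegularity

/-! ### Leading eigenvectors and the spectral initialization -/

section Spectral

variable {d n : ℕ}

/-- `w ↦ a w` as a continuous real-linear map. -/
def rightMulCLM (a : QVec d) : ℍ[ℝ] →L[ℝ] QVec d :=
  LinearMap.mkContinuous
    { toFun := rightMul a
      map_add' := fun v w => PiLp.ext fun j => by simp [rightMul, mul_add]
      map_smul' := fun r w => PiLp.ext fun j => by simp [rightMul] } ‖a‖
    (fun w => (norm_rightMul a w).le)

@[simp] theorem rightMulCLM_apply (a : QVec d) (w : ℍ[ℝ]) : rightMulCLM a w = rightMul a w := rfl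

/-- The operator `(1/n) ∑ w_k α_k α_k^*`. -/
def weightedGram (A : Fin n → QVec d) (w : Fin n → ℝ) : QVec d →L[ℝ] QVec d :=
  (1 / (n : ℝ)) • ∑ k, w k • (rightMulCLM (A k)).comp (qInnerCLM (A k))

theorem real_inner_weightedGram (A : Fin n → QVec d) (w : Fin n → ℝ) (y z : QVec d) :
    inner ℝ (weightedGram A w y) z =
      (1 / (n : ℝ)) * ∑ k, w k * inner ℝ (qInner (A k) y) (qInner (A k) z) := by
  simp only [weightedGram, smul_apply, sum_apply,
    ContinuousLinearMap.comp_apply, qInnerCLM_apply, rightMulCLM_apply, real_inner_smul_left,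
    sum_inner]
  congr 1
  refine Finset.sum_congr rfl fun k _ => ?_
  rw [real_inner_rightMul_left, real_inner_comm, Quaternion.inner_def]
  congr 1
  simp only [Quaternion.re_mul, Quaternion.re_star, Quaternion.imI_star,
    Quaternion.imJ_star, Quaternion.imK_star]
  ring

theorem real_inner_weightedGram_self (A : Fin n → QVec d) (w : Fin n → ℝ) (y : QVec d) :
    inner ℝ (weightedGram A w y) y = (1 / (n : ℝ)) * ∑ k, w k * ‖qInner (A k) y‖ ^ 2 := by
  simp only [real_inner_weightedGram, real_inner_self_eq_norm_sq]

theorem isSelfAdjoint_weightedGram (A : Fin n → QVec d) (w : Fin n → ℝ) :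
    IsSelfAdjoint (weightedGram A w) := by
  rw [ContinuousLinearMap.isSelfAdjoint_iff_isSymmetric]
  intro y z
  change inner ℝ (weightedGram A w y) z = inner ℝ y (weightedGram A w z)
  rw [real_inner_comm _ y, real_inner_weightedGram, real_inner_weightedGram]
  congr 1
  exact Finset.sum_congr rfl fun k _ => by rw [real_inner_comm]

theorem initMatrix_mulVec (A : Fin n → QVec d) (ψ : Fin n → ℝ) (γ : ℝ) (v : QVec d) (i : Fin d) :
    ∑ j, initMatrix A ψ γ i j * v j =
      weightedGram A (fun k => γ - Real.exp (-(ψ k ^ 2 / normEstimate ψ ^ 2))) v i := by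
  simp only [weightedGram, smul_apply, sum_apply,
    ContinuousLinearMap.comp_apply, qInnerCLM_apply, rightMulCLM_apply, initMatrix, rightMul,
    qInner, PiLp.smul_apply, WithLp.ofLp_sum, Finset.sum_apply, WithLp.ofLp_smul, Pi.smul_apply,
    smul_mul_assoc, ← Finset.smul_sum, Finset.sum_mul, Finset.mul_sum]
  congr 1
  rw [Finset.sum_comm]
  refine Finset.sum_congr rfl fun k _ => ?_
  rw [Finset.smul_sum]
  exact Finset.sum_congr rfl fun j _ => by rw [mul_assoc]

/-- The Rayleigh quotient attains its maximum on the compact unit sphere of the underlying real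
space, and a maximiser is an eigenvector. The vector x only ensures that the sphere is nonempty. -/
theorem exists_eigenvector_of_isSelfAdjoint {T : QVec d →L[ℝ] QVec d} (hT : IsSelfAdjoint T)
    {x : QVec d} (hx : x ≠ 0) :
    ∃ v : QVec d, ‖v‖ = 1 ∧ T v = (inner ℝ (T v) v : ℝ) • v ∧
      ∀ y : QVec d, ‖y‖ = 1 → inner ℝ (T y) y ≤ inner ℝ (T v) v := by
  have : ProperSpace (QVec d) := FiniteDimensional.proper ℝ _
  have hne : (Metric.sphere (0 : QVec d) 1).Nonempty :=
    ⟨‖x‖⁻¹ • x, by simp [norm_smul, norm_ne_zero_iff.2 hx]⟩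
  have hcont : Continuous fun y : QVec d => (inner ℝ (T y) y : ℝ) :=
    T.continuous.inner continuous_id
  obtain ⟨v, hv, hmax⟩ := (isCompact_sphere (0 : QVec d) 1).exists_isMaxOn hne hcont.continuousOn
  have hv1 : ‖v‖ = 1 := by simpa using hv
  have hv0 : v ≠ 0 := fun h => by simp [h] at hv1
  have hmax' : IsMaxOn T.reApplyInnerSelf (Metric.sphere 0 ‖v‖) v := by
    rw [hv1]; exact hmax
  have hev := IsSelfAdjoint.hasEigenvector_of_isMaxOn hT hv0 hmax'
  have heq := hev.apply_eq_smul
  refine ⟨v, hv1, ?_, fun y hy => hmax (by simpa using hy)⟩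
  change T v = _ at heq
  have : (inner ℝ (T v) v : ℝ) • v = T v := by
    rw [heq, real_inner_smul_left, real_inner_self_eq_norm_sq, hv1]; simp
  exact this.symm

/-- A right eigenvalue equation for a real-linear operator determines the Rayleigh quotient. -/
theorem real_inner_of_right_eigen {T : QVec d →L[ℝ] QVec d} {v : QVec d} {q : ℍ[ℝ]}
    (h : ∀ i, T v i = v i * q) : inner ℝ (T v) v = q.re * ‖v‖ ^ 2 := by
  have : T v = rightMul v q := PiLp.ext fun i => by rw [h]; rfl
  rw [this, real_inner_rightMul_left, qInner_self, ← Quaternion.coe_commutes,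
    Quaternion.coe_mul_eq_smul, Quaternion.re_smul, Quaternion.re_star, smul_eq_mul, mul_comm]

/-- The eigenvalue of the real maximiser is real, hence commutes with quaternions and is a right
eigenvalue. It dominates every standard eigenvalue q because q.re is itself a Rayleigh quotient. -/
theorem exists_isLeadingEigenvector (A : Fin n → QVec d) (ψ : Fin n → ℝ) (γ : ℝ) {x : QVec d}
    (hx : x ≠ 0) : ∃ v, IsLeadingEigenvector (initMatrix A ψ γ) v := by
  obtain ⟨v, hv1, hv, hmax⟩ := exists_eigenvector_of_isSelfAdjoint (isSelfAdjoint_weightedGram A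
    (fun k => γ - Real.exp (-(ψ k ^ 2 / normEstimate ψ ^ 2)))) hx
  refine ⟨v, hv1, inner ℝ (weightedGram A (fun k => γ - Real.exp (-(ψ k ^ 2 /
    normEstimate ψ ^ 2))) v) v, ⟨fun h => by simp [h] at hv1, fun i => ?_⟩, ?_⟩
  · rw [initMatrix_mulVec, ← Quaternion.coe_commutes, Quaternion.coe_mul_eq_smul]
    exact congrArg (fun y : QVec d => y i) hv
  · rintro q ⟨⟨y, hy0, hy⟩, -⟩
    have hn : 0 < ‖y‖ := norm_pos_iff.2 hy0
    have h1 := real_inner_of_right_eigen fun i => (initMatrix_mulVec A ψ γ y i).symm.trans (hy i)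
    have h2 := hmax (‖y‖⁻¹ • y) (by simp [norm_smul, hn.ne'])
    rw [map_smul, real_inner_smul_left, real_inner_smul_right, h1] at h2
    refine le_trans (le_of_eq ?_) h2
    field_simp

/-- The real maximum is a standard eigenvalue, so every leading eigenvector, not only the one
constructed, attains it. -/
theorem IsLeadingEigenvector.rayleigh_le {A : Fin n → QVec d} {ψ : Fin n → ℝ} {γ : ℝ}
    {v : QVec d} (hv : IsLeadingEigenvector (initMatrix A ψ γ) v) {y : QVec d} (hy : ‖y‖ = 1) :
    inner ℝ (weightedGram A (fun k => γ - Real.exp (-(ψ k ^ 2 / normEstimate ψ ^ 2))) y) y ≤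
      inner ℝ (weightedGram A (fun k => γ - Real.exp (-(ψ k ^ 2 / normEstimate ψ ^ 2))) v) v := by
  obtain ⟨hv1, m, ⟨-, hm⟩, hmax⟩ := hv
  have hy0 : y ≠ 0 := fun h => by simp [h] at hy
  obtain ⟨u, hu1, hu, humax⟩ := exists_eigenvector_of_isSelfAdjoint (isSelfAdjoint_weightedGram A
    (fun k => γ - Real.exp (-(ψ k ^ 2 / normEstimate ψ ^ 2)))) hy0
  have h1 := real_inner_of_right_eigen fun i => (initMatrix_mulVec A ψ γ v i).symm.trans (hm i)
  rw [hv1, Quaternion.re_coe, one_pow, mul_one] at h1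
  have h2 := hmax ((inner ℝ (weightedGram A
      (fun k => γ - Real.exp (-(ψ k ^ 2 / normEstimate ψ ^ 2))) u) u : ℝ) : ℍ[ℝ])
    ⟨⟨u, fun h => by simp [h] at hu1, fun i => by
      rw [initMatrix_mulVec, ← Quaternion.coe_commutes, Quaternion.coe_mul_eq_smul]
      exact congrArg (fun y : QVec d => y i) hu⟩, by simp, by simp, by simp⟩
  rw [Quaternion.re_coe] at h2
  exact (humax y hy).trans (h2.trans h1.ge)

/-- A relative change c of the exponent a moves e^{-a} by at most c·a·e^{-a} ≤ c. With m = λ₀²/‖x‖²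
this replaces the estimated norm by the true one inside the weights. -/
theorem abs_exp_neg_sub_exp_neg_le {s m δ : ℝ} (hs : 0 ≤ s) (hδ : δ ≤ 1 / 2)
    (hm : |m - 1| ≤ δ) : |Real.exp (-(s / m)) - Real.exp (-s)| ≤ 2 * δ := by
  have key : ∀ {a b c : ℝ}, 0 ≤ a → 0 ≤ c → b - a = c * a →
      |Real.exp (-a) - Real.exp (-b)| ≤ c := by
    intro a b c ha hc hb
    have h1 : Real.exp (-b) = Real.exp (-a) * Real.exp (-(c * a)) := by
      rw [← Real.exp_add]; congr 1; linarith
    have h2 : 1 - c * a ≤ Real.exp (-(c * a)) := by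
      have := Real.add_one_le_exp (-(c * a)); linarith
    have h3 : Real.exp (-(c * a)) ≤ 1 := Real.exp_le_one_iff.2 (by nlinarith)
    have h4 : Real.exp (-a) * a ≤ 1 := by
      have h5 : a ≤ Real.exp a := by have := Real.add_one_le_exp a; linarith
      rw [Real.exp_neg, inv_mul_le_iff₀ (Real.exp_pos a)]; linarith
    have h6 := Real.exp_pos (-a)
    rw [h1, abs_of_nonneg (by nlinarith)]
    nlinarith [mul_le_mul_of_nonneg_left h2 h6.le, mul_le_mul_of_nonneg_left h4 hc]
  have hm1 := abs_le.1 hm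
  have hm0 : 0 < m := by linarith
  rcases le_total 1 m with h | h
  · refine (key (c := m - 1) (div_nonneg hs hm0.le) (by linarith) ?_).trans (by linarith)
    field_simp
  · rw [abs_sub_comm]
    refine (key (c := (1 - m) / m) hs (div_nonneg (by linarith) hm0.le) ?_).trans ?_
    · field_simp
    · rw [div_le_iff₀ hm0]; nlinarith

theorem amplitudes_eq_norm_mul (A : Fin n → QVec d) {x : QVec d} (hx : x ≠ 0) (k : Fin n) :
    amplitudes A x k = ‖x‖ * ‖qInner (A k) (‖x‖⁻¹ • x)‖ := by
  have hxn : ‖x‖ ≠ 0 := norm_ne_zero_iff.2 hx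
  rw [amplitudes, qInner_smul_right, norm_smul, norm_inv, norm_norm, mul_inv_cancel_left₀ hxn]

theorem normEstimate_sq (A : Fin n → QVec d) {x : QVec d} (hx : x ≠ 0) :
    normEstimate (amplitudes A x) ^ 2 =
      ‖x‖ ^ 2 * ((1 / (n : ℝ)) * ∑ k, ‖qInner (A k) (‖x‖⁻¹ • x)‖ ^ 2) := by
  rw [normEstimate, Real.sq_sqrt (by positivity)]
  simp only [amplitudes_eq_norm_mul A hx, mul_pow, ← Finset.mul_sum]
  ring

theorem correlation_leadingEigenvector_ge {κ q δ γ : ℝ} (hκ : 0 < κ) (hδ0 : 0 < δ)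
    (hδ : δ ≤ 1 / 2) {A : Fin n → QVec d} {x : QVec d} (hx : x ≠ 0)
    (hM : ∀ h, ‖h‖ = 1 → |(1 / (n : ℝ)) * ∑ k, ‖qInner (A k) h‖ ^ 2 - 1| ≤ δ)
    (hE : ∀ h, ‖h‖ = 1 → |(1 / (n : ℝ)) * ∑ k,
      Real.exp (-‖qInner (A k) (‖x‖⁻¹ • x)‖ ^ 2) * ‖qInner (A k) h‖ ^ 2
        - (q - κ * ‖qInner (‖x‖⁻¹ • x) h‖ ^ 2)| ≤ δ)
    {v : QVec d} (hv : IsLeadingEigenvector (initMatrix A (amplitudes A x) γ) v) :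
    1 - ‖qInner (‖x‖⁻¹ • x) v‖ ≤ (10 + 2 * |γ|) * δ / κ := by
  have hn0 : (0 : ℝ) ≤ 1 / (n : ℝ) := by positivity
  have hxn : 0 < ‖x‖ := norm_pos_iff.2 hx
  have hlam2 := normEstimate_sq A hx
  have hax := amplitudes_eq_norm_mul A hx
  have he1 : ‖‖x‖⁻¹ • x‖ = 1 := by simp [norm_smul, hxn.ne']
  generalize ‖x‖⁻¹ • x = e at *
  have hv1 := hv.1
  set M : QVec d → ℝ := fun h => (1 / (n : ℝ)) * ∑ k, ‖qInner (A k) h‖ ^ 2 with hMdef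
  have hMe : |M e - 1| ≤ δ := hM e he1
  have hMv : |M v - 1| ≤ δ := hM v hv1
  set E : QVec d → ℝ := fun h => (1 / (n : ℝ)) * ∑ k,
      Real.exp (-‖qInner (A k) e‖ ^ 2) * ‖qInner (A k) h‖ ^ 2 with hEdef
  set E' : QVec d → ℝ := fun h => (1 / (n : ℝ)) * ∑ k,
      Real.exp (-(amplitudes A x k ^ 2 / normEstimate (amplitudes A x) ^ 2)) *
        ‖qInner (A k) h‖ ^ 2 with hE'def
  have hEE : ∀ h, |E' h - E h| ≤ 2 * δ * M h := by
    intro h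
    simp only [hEdef, hE'def, hMdef, ← mul_sub, ← Finset.sum_sub_distrib]
    rw [abs_mul, abs_of_nonneg hn0, mul_left_comm, Finset.mul_sum]
    refine mul_le_mul_of_nonneg_left ((Finset.abs_sum_le_sum_abs _ _).trans
      (Finset.sum_le_sum fun k _ => ?_)) hn0
    rw [← sub_mul, abs_mul, abs_of_nonneg (sq_nonneg ‖qInner (A k) h‖)]
    refine mul_le_mul_of_nonneg_right ?_ (sq_nonneg _)
    have := abs_exp_neg_sub_exp_neg_le (s := ‖qInner (A k) e‖ ^ 2) (sq_nonneg _) hδ hMe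
    rw [hlam2, hax, mul_pow, mul_div_mul_left _ _ (by positivity)]
    exact this
  have hray := hv.rayleigh_le he1
  have hsplit : ∀ h, inner ℝ (weightedGram A (fun k => γ - Real.exp (-(amplitudes A x k ^ 2 /
      normEstimate (amplitudes A x) ^ 2))) h) h = γ * M h - E' h := by
    intro h
    rw [real_inner_weightedGram_self]
    simp only [hMdef, hE'def, sub_mul, Finset.sum_sub_distrib, ← Finset.mul_sum]
    ring
  rw [hsplit, hsplit] at hray
  have hEe : |E e - (q - κ * ‖qInner e e‖ ^ 2)| ≤ δ := hE e he1
  have hEv : |E v - (q - κ * ‖qInner e v‖ ^ 2)| ≤ δ := hE v hv1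
  have hee := hEE e
  have hvv := hEE v
  have hqe : ‖qInner e e‖ = 1 := by rw [qInner_self, he1]; simp
  have hc1 : ‖qInner e v‖ ≤ 1 := by
    have := norm_qInner_le e v
    rwa [he1, hv1, one_mul] at this
  have hc0 := norm_nonneg (qInner e v)
  rw [hqe] at hEe
  generalize ‖qInner e v‖ = c at *
  generalize M e = Me at *
  generalize M v = Mv at *
  generalize E e = Ee at *
  generalize E v = Ev at *
  generalize E' e = Ee' at *
  generalize E' v = Ev' at *
  rw [abs_le] at hMe hMv hEe hEv hee hvv
  have hγ : γ * (Mv - Me) ≤ |γ| * (2 * δ) := by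
    calc _ ≤ |γ * (Mv - Me)| := le_abs_self _
      _ = |γ| * |Mv - Me| := abs_mul _ _
      _ ≤ _ := by
        gcongr
        rw [abs_le]; constructor <;> linarith [hMe.1, hMe.2, hMv.1, hMv.2]
  have hde : 2 * δ * Me ≤ 2 * δ * 2 := by
    gcongr; linarith [hMe.2]
  have hdv : 2 * δ * Mv ≤ 2 * δ * 2 := by
    gcongr; linarith [hMv.2]
  -- Error count: 4δ at each of e and v for the norm estimate in the weights, δ at each for
  -- concentration, and 2|γ|δ for the Gram forms.
  have hgap : κ * (1 - c ^ 2) ≤ (10 + 2 * |γ|) * δ := by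
    linarith [hee.1, hee.2, hvv.1, hvv.2, hEe.1, hEe.2, hEv.1, hEv.2]
  -- For 0 ≤ c ≤ 1 one has 1 - c ≤ 1 - c².
  rw [le_div_iff₀ hκ]
  have := mul_nonneg hκ.le (mul_nonneg hc0 (sub_nonneg.2 hc1))
  linarith

/-- Accuracy of the spectral initial guess under concentration of the quadratic forms. -/
theorem phaseDist_initial_le {κ q δ ρ γ : ℝ} (hκ : 0 < κ) (hδ0 : 0 < δ) (hδ : δ ≤ 1 / 2)
    (hρ : 0 ≤ ρ) (hδρ : δ * (1 + (40 + 8 * |γ|) / κ) ≤ ρ ^ 2)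
    {A : Fin n → QVec d} {x : QVec d} (hx : x ≠ 0)
    (hM : ∀ h, ‖h‖ = 1 → |(1 / (n : ℝ)) * ∑ k, ‖qInner (A k) h‖ ^ 2 - 1| ≤ δ)
    (hE : ∀ h, ‖h‖ = 1 → |(1 / (n : ℝ)) * ∑ k,
      Real.exp (-‖qInner (A k) (‖x‖⁻¹ • x)‖ ^ 2) * ‖qInner (A k) h‖ ^ 2
        - (q - κ * ‖qInner (‖x‖⁻¹ • x) h‖ ^ 2)| ≤ δ)
    {v : QVec d} (hv : IsLeadingEigenvector (initMatrix A (amplitudes A x) γ) v) :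
    phaseDist (normEstimate (amplitudes A x) • v) x ≤ ρ * ‖x‖ := by
  have hxn : 0 < ‖x‖ := norm_pos_iff.2 hx
  have hcor := correlation_leadingEigenvector_ge hκ hδ0 hδ hx hM hE hv
  have hlam2 := normEstimate_sq A hx
  have he1 : ‖‖x‖⁻¹ • x‖ = 1 := by simp [norm_smul, hxn.ne']
  have hMe := hM _ he1
  have hlam0 : 0 ≤ normEstimate (amplitudes A x) := Real.sqrt_nonneg _
  have hc1 : ‖qInner (‖x‖⁻¹ • x) v‖ ≤ 1 := by
    have := norm_qInner_le (‖x‖⁻¹ • x) v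
    rwa [he1, hv.1, one_mul] at this
  have hqx : ‖qInner x (normEstimate (amplitudes A x) • v)‖ =
      ‖x‖ * normEstimate (amplitudes A x) * ‖qInner (‖x‖⁻¹ • x) v‖ := by
    rw [qInner_smul_left, qInner_smul_right, norm_smul, norm_smul, norm_inv, norm_norm,
      Real.norm_eq_abs, abs_of_nonneg hlam0]
    field_simp
  have hdist := phaseDist_sq (normEstimate (amplitudes A x) • v) x
  rw [hqx, norm_smul, hv.1, mul_one, Real.norm_eq_abs, sq_abs] at hdist
  refine (pow_le_pow_iff_left₀ (phaseDist_nonneg _ _) (by positivity) two_ne_zero).1 ?_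
  rw [hdist]
  generalize normEstimate (amplitudes A x) = lam at *
  generalize ‖qInner (‖x‖⁻¹ • x) v‖ = c at *
  generalize (1 / (n : ℝ)) * ∑ k, ‖qInner (A k) (‖x‖⁻¹ • x)‖ ^ 2 = m at *
  generalize ‖x‖ = s at *
  have hm := abs_le.1 hMe
  have hlamle : lam ≤ 2 * s := by
    refine (pow_le_pow_iff_left₀ hlam0 (by positivity) two_ne_zero).1 ?_
    rw [hlam2, mul_pow, mul_comm]; gcongr; linarith
  have hsub : (lam - s) ^ 2 ≤ δ * s ^ 2 := by
    have h1 : |lam - s| ≤ δ * s := by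
      have h3 : (lam - s) * (lam + s) = s ^ 2 * (m - 1) := by linear_combination hlam2
      have h2 : |lam - s| * (lam + s) ≤ s ^ 2 * δ := by
        rw [← abs_of_nonneg (by positivity : 0 ≤ lam + s), ← abs_mul, h3, abs_mul,
          abs_of_nonneg (sq_nonneg s)]
        gcongr
      have h4 : |lam - s| * s ≤ δ * s * s := by
        have : |lam - s| * s ≤ |lam - s| * (lam + s) := by gcongr; linarith
        linarith
      exact le_of_mul_le_mul_right h4 hxn
    calc (lam - s) ^ 2 = |lam - s| ^ 2 := (sq_abs _).symm
      _ ≤ (δ * s) ^ 2 := by gcongr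
      _ = δ * δ * s ^ 2 := by ring
      _ ≤ 1 * δ * s ^ 2 := by gcongr; linarith
      _ = _ := by ring
  -- The squared distance is (λ₀-s)² + 2λ₀s(1-c) with s = ‖x‖; bounding λ₀ by 2s turns 10 + 2|γ|
  -- into 40 + 8|γ|.
  have h1 : 2 * (lam * s) * (1 - c) ≤ 2 * (2 * s * s) * ((10 + 2 * |γ|) * δ / κ) := by
    have : 0 ≤ 1 - c := by linarith
    gcongr
  calc lam ^ 2 + s ^ 2 - 2 * (s * lam * c) = (lam - s) ^ 2 + 2 * (lam * s) * (1 - c) := by ring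
    _ ≤ δ * s ^ 2 + 2 * (2 * s * s) * ((10 + 2 * |γ|) * δ / κ) := add_le_add hsub h1
    _ = δ * (1 + (40 + 8 * |γ|) / κ) * s ^ 2 := by field_simp; ring
    _ ≤ ρ ^ 2 * s ^ 2 := by gcongr
    _ = _ := by ring

end Spectral

/-! ### Quaternionic Gaussian vectors -/

instance instMeasurableSpaceQuaternion : MeasurableSpace ℍ[ℝ] := borel _

instance instBorelSpaceQuaternion : BorelSpace ℍ[ℝ] := ⟨rfl⟩

section GaussianLaw

/-- The centred Gaussian measure with covariance `1/4` on a Euclidean space. -/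
def halfGaussian (E : Type*) [NormedAddCommGroup E] [InnerProductSpace ℝ E]
    [FiniteDimensional ℝ E] [MeasurableSpace E] : Measure E :=
  (stdGaussian E).map ((1 / 2 : ℝ) • ·)

variable {E : Type*} [NormedAddCommGroup E] [InnerProductSpace ℝ E]
    [FiniteDimensional ℝ E] [MeasurableSpace E] [BorelSpace E]

instance : IsProbabilityMeasure (halfGaussian E) :=
  Measure.isProbabilityMeasure_map (by fun_prop)

theorem charFun_halfGaussian (t : E) :
    charFun (halfGaussian E) t = Complex.exp (-‖t‖ ^ 2 / 8) := by
  rw [halfGaussian, charFun_map_smul, charFun_stdGaussian, norm_smul]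
  congr 1
  push_cast
  norm_num
  ring

end GaussianLaw

/-! ### From independent real coordinates to independent Gaussian vectors. -/

section Coordinates

variable {d n : ℕ}

theorem real_inner_eq_sum_coords (a t : QVec d) :
    inner ℝ a t = ∑ p : Fin d × Fin 4, coords (a p.1) p.2 * coords (t p.1) p.2 := by
  rw [PiLp.inner_apply, Fintype.sum_prod_type]
  refine Finset.sum_congr rfl fun j _ => ?_
  simp [Fin.sum_univ_four, coords, Quaternion.inner_def, Quaternion.re_mul]

/-- The vector with given real coordinates. -/
def ofCoords (f : Fin d × Fin 4 → ℝ) : QVec d :=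
  WithLp.toLp 2 fun j => Quaternion.linearIsometryEquivTuple.symm
    (WithLp.toLp 2 fun c => f (j, c))

theorem ofCoords_coords (a : QVec d) : ofCoords (fun p => coords (a p.1) p.2) = a := by
  refine PiLp.ext fun j => ?_
  ext <;> simp [ofCoords, coords]

theorem continuous_ofCoords : Continuous (ofCoords : (Fin d × Fin 4 → ℝ) → QVec d) := by
  refine (PiLp.continuous_toLp 2 _).comp (continuous_pi fun j => ?_)
  refine (LinearIsometryEquiv.continuous _).comp ((PiLp.continuous_toLp 2 _).comp ?_)
  fun_prop

variable {Ω : Type*} [MeasurableSpace Ω] {P : Measure Ω} {α : Fin n → Ω → QVec d}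

theorem IsQuaternionGaussian.aemeasurable (h : IsQuaternionGaussian P α) (k : Fin n) :
    AEMeasurable (α k) P := by
  have h1 : AEMeasurable (fun ω (p : Fin d × Fin 4) => coords (α k ω p.1) p.2) P :=
    aemeasurable_pi_lambda _ fun p => (h.law k p.1 p.2).aemeasurable
  have h2 := continuous_ofCoords.measurable.comp_aemeasurable h1
  simpa only [Function.comp_def, ofCoords_coords] using h2

/-- The joint characteristic function of all vectors contains both facts needed later: supported at
one index it identifies the law of α_k, and its factorisation over k is independence. -/
theorem IsQuaternionGaussian.integral_exp [IsProbabilityMeasure P]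
    (h : IsQuaternionGaussian P α) (t : Fin n → QVec d) :
    ∫ ω, Complex.exp ((∑ k, inner ℝ (α k ω) (t k) : ℝ) * Complex.I) ∂P =
      Complex.exp (-(∑ k, ‖t k‖ ^ 2 : ℝ) / 8) := by
  have hlaw : HasLaw (fun ω (p : Fin n × Fin d × Fin 4) => coords (α p.1 ω p.2.1) p.2.2)
      (Measure.pi fun _ => gaussianReal 0 (1 / 4)) P :=
    iIndepFun.hasLaw_pi (fun p => h.law p.1 p.2.1 p.2.2) h.indep
  have h1 : ∀ ω, Complex.exp ((∑ k, inner ℝ (α k ω) (t k) : ℝ) * Complex.I) =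
      (fun f : Fin n × Fin d × Fin 4 → ℝ =>
        ∏ p, Complex.exp ((coords (t p.1 p.2.1) p.2.2 : ℂ) * (f p : ℂ) * Complex.I))
        (fun p => coords (α p.1 ω p.2.1) p.2.2) := by
    intro ω
    simp only [real_inner_eq_sum_coords]
    rw [← Complex.exp_sum, Fintype.sum_prod_type (f := fun p : Fin n × Fin d × Fin 4 => _)]
    push_cast
    simp only [Finset.sum_mul]
    congr 1
    refine Finset.sum_congr rfl fun k _ => Finset.sum_congr rfl fun p _ => ?_
    ring
  refine (integral_congr_ae (Filter.Eventually.of_forall h1)).trans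
    ((hlaw.integral_comp (f := fun f : Fin n × Fin d × Fin 4 → ℝ =>
        ∏ p, Complex.exp ((coords (t p.1 p.2.1) p.2.2 : ℂ) * (f p : ℂ) * Complex.I))
        (Measurable.aestronglyMeasurable (by fun_prop))).trans ?_)
  rw [integral_fintype_prod_eq_prod (f := fun (p : Fin n × Fin d × Fin 4) (x : ℝ) =>
      Complex.exp ((coords (t p.1 p.2.1) p.2.2 : ℂ) * (x : ℂ) * Complex.I))]
  simp_rw [← charFun_apply_real, charFun_gaussianReal, ← Complex.exp_sum]
  congr 1
  simp only [← real_inner_self_eq_norm_sq, real_inner_eq_sum_coords]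
  rw [Fintype.sum_prod_type]
  push_cast
  simp only [← Finset.sum_neg_distrib, Finset.sum_div]
  refine Finset.sum_congr rfl fun k _ => Finset.sum_congr rfl fun p _ => ?_
  ring

theorem IsQuaternionGaussian.hasLaw [IsProbabilityMeasure P]
    (h : IsQuaternionGaussian P α) (k : Fin n) : HasLaw (α k) (halfGaussian (QVec d)) P where
  aemeasurable := h.aemeasurable k
  map_eq := by
    have := Measure.isProbabilityMeasure_map (h.aemeasurable k)
    refine Measure.ext_of_charFun (funext fun t => ?_)
    rw [charFun_apply, integral_map (h.aemeasurable k)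
      (Measurable.aestronglyMeasurable (by fun_prop)), charFun_halfGaussian]
    have := h.integral_exp (Pi.single k t)
    rw [Finset.sum_eq_single k (fun j _ hj => by simp [hj]) (by simp)] at this
    simp only [Pi.single_eq_same] at this
    rw [← Complex.ofReal_pow, ← this]
    refine integral_congr_ae (Filter.Eventually.of_forall fun ω => ?_)
    simp only
    rw [Finset.sum_eq_single k (fun j _ hj => by simp [hj]) (by simp)]
    simp

theorem IsQuaternionGaussian.iIndepFun [IsProbabilityMeasure P]
    (h : IsQuaternionGaussian P α) : ProbabilityTheory.iIndepFun α P := by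
  rw [iIndepFun_iff_charFun_pi h.aemeasurable]
  intro t
  have hm : AEMeasurable (fun ω => WithLp.toLp 2 (α · ω)) P := by
    have : AEMeasurable (fun ω => (α · ω)) P := aemeasurable_pi_lambda _ h.aemeasurable
    exact (PiLp.continuous_toLp 2 _).measurable.comp_aemeasurable this
  rw [charFun_apply, integral_map hm (Measurable.aestronglyMeasurable (by fun_prop))]
  have hin : ∀ ω, inner ℝ (WithLp.toLp 2 (α · ω)) t = ∑ k, inner ℝ (α k ω) (t k) :=
    fun ω => PiLp.inner_apply _ _
  simp only [hin]
  rw [h.integral_exp]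
  simp only [(h.hasLaw _).map_eq, charFun_halfGaussian, ← Complex.exp_sum]
  congr 1
  push_cast
  simp only [← Finset.sum_neg_distrib, Finset.sum_div]

end Coordinates

/-! ### Laws of the products a^*h. -/

section Marginals

variable {d : ℕ}

/-- Expresses the characteristic function of a^*h at t as that of a at h t̄, whose norm is ‖h‖|t|.
-/
theorem real_inner_qInner (a h : QVec d) (t : ℍ[ℝ]) :
    inner ℝ (qInner a h) t = inner ℝ a (rightMul h (star t)) := by
  rw [← re_qInner, qInner_rightMul_right, Quaternion.inner_def]

theorem continuous_qInner_left (h : QVec d) : Continuous fun a => qInner a h :=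
  (qInnerFlipCLM h).continuous

theorem measurable_qInner_left (h : QVec d) : Measurable fun a => qInner a h :=
  (continuous_qInner_left h).measurable

/-- The law of `a^* h` for a quaternionic Gaussian vector `a`. -/
theorem map_qInner_halfGaussian (h : QVec d) :
    (halfGaussian (QVec d)).map (fun a => qInner a h) =
      (halfGaussian ℍ[ℝ]).map (‖h‖ • ·) := by
  have := Measure.isProbabilityMeasure_map (μ := halfGaussian (QVec d))
    (measurable_qInner_left h).aemeasurable
  have : IsProbabilityMeasure ((halfGaussian ℍ[ℝ]).map (‖h‖ • ·)) :=
    Measure.isProbabilityMeasure_map (by fun_prop)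
  refine Measure.ext_of_charFun (funext fun t => ?_)
  rw [charFun_map_smul, charFun_halfGaussian, charFun_apply,
    integral_map (measurable_qInner_left h).aemeasurable
      (Measurable.aestronglyMeasurable (by fun_prop))]
  simp only [real_inner_qInner]
  rw [← charFun_apply, charFun_halfGaussian, norm_rightMul, norm_star, norm_smul, norm_norm]

/-- `a^* x` and `a^* w` are independent if `x^* w = 0`. -/
theorem indepFun_qInner {x w : QVec d} (hxw : qInner x w = 0) :
    IndepFun (fun a => qInner a x) (fun a => qInner a w) (halfGaussian (QVec d)) := by
  rw [indepFun_iff_charFun_prod (measurable_qInner_left x).aemeasurable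
    (measurable_qInner_left w).aemeasurable]
  intro t
  have hm : Measurable fun a : QVec d => WithLp.toLp 2 (qInner a x, qInner a w) :=
    (WithLp.prod_continuous_toLp 2 _ _).measurable.comp
      ((measurable_qInner_left x).prodMk (measurable_qInner_left w))
  rw [map_qInner_halfGaussian, map_qInner_halfGaussian, charFun_map_smul, charFun_map_smul,
    charFun_halfGaussian, charFun_halfGaussian, charFun_apply, integral_map hm.aemeasurable
      (Measurable.aestronglyMeasurable (by fun_prop))]
  simp only [WithLp.prod_inner_apply, real_inner_qInner, ← inner_add_right]
  rw [← charFun_apply, charFun_halfGaussian, ← Complex.exp_add, ← Complex.ofReal_pow,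
    norm_add_sq_real]
  -- Since x^*w = 0, right multiples of x and of w are real-orthogonal, so the Gaussian exponent
  -- splits.
  have h0 : inner ℝ (rightMul x (star t.ofLp.1)) (rightMul w (star t.ofLp.2)) = 0 := by
    rw [real_inner_rightMul_left, qInner_rightMul_right, hxw]; simp
  rw [h0, norm_rightMul, norm_rightMul, norm_star, norm_star, norm_smul, norm_smul, norm_norm,
    norm_norm]
  congr 1
  push_cast
  ring

end Marginals

/-! ### Concentration for sums of independent nonnegative variables -/

section Chernoff

theorem abs_exp_sub_one_sub_le (x : ℝ) :
    |Real.exp x - 1 - x| ≤ x ^ 2 * Real.exp |x| := by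
  have h := Complex.norm_exp_sub_sum_le_norm_mul_exp (x : ℂ) 2
  simp only [Finset.sum_range_succ, Finset.sum_range_zero, pow_zero, Nat.factorial_zero,
    Nat.cast_one, div_one, zero_add, pow_one, Nat.factorial_one] at h
  rw [← sub_sub] at h
  rw [← Complex.ofReal_exp, ← Complex.ofReal_one, ← Complex.ofReal_sub, ← Complex.ofReal_sub,
    Complex.norm_real, Complex.norm_real, Real.norm_eq_abs, Real.norm_eq_abs, sq_abs] at h
  exact h

/-- Second-order Taylor expansion with remainder (θy)²e^{|θ|y}. Half of the exponent Cy dominates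
y², the other half dominates |θ|y. -/
theorem exp_mul_le_of_nonneg {C θ y : ℝ} (hC : 0 < C) (hθ : |θ| ≤ C / 2) (hy : 0 ≤ y) :
    Real.exp (θ * y) ≤ 1 + θ * y + θ ^ 2 * (8 / C ^ 2 * Real.exp (C * y)) := by
  have h1 := (le_abs_self _).trans (abs_exp_sub_one_sub_le (θ * y))
  have h2 : |θ * y| ≤ C / 2 * y := by
    rw [abs_mul, abs_of_nonneg hy]; gcongr
  have h3 : (C / 2 * y) ^ 2 / 2 ≤ Real.exp (C / 2 * y) := by
    have := Real.quadratic_le_exp_of_nonneg (show 0 ≤ C / 2 * y by positivity)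
    nlinarith [show 0 ≤ C / 2 * y by positivity]
  have h4 : y ^ 2 ≤ 8 / C ^ 2 * Real.exp (C / 2 * y) := by
    rw [div_mul_eq_mul_div, le_div_iff₀ (by positivity)]
    nlinarith
  have h5 : (θ * y) ^ 2 * Real.exp |θ * y| ≤ θ ^ 2 * (8 / C ^ 2 * Real.exp (C * y)) := by
    calc (θ * y) ^ 2 * Real.exp |θ * y|
        ≤ (θ * y) ^ 2 * Real.exp (C / 2 * y) := by gcongr
      _ = θ ^ 2 * (y ^ 2 * Real.exp (C / 2 * y)) := by ring
      _ ≤ θ ^ 2 * (8 / C ^ 2 * Real.exp (C / 2 * y) * Real.exp (C / 2 * y)) := by gcongr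
      _ = θ ^ 2 * (8 / C ^ 2 * Real.exp (C * y)) := by
        rw [mul_assoc (8 / C ^ 2), ← Real.exp_add]; ring_nf
  linarith

variable {Ω : Type*} [MeasurableSpace Ω] {P : Measure Ω}

theorem integrable_of_integrable_exp {C : ℝ} (hC : 0 < C) {Y : Ω → ℝ} (hm : AEMeasurable Y P)
    (h0 : ∀ ω, 0 ≤ Y ω) (h_int : Integrable (fun ω => Real.exp (C * Y ω)) P) : Integrable Y P := by
  refine (h_int.const_mul C⁻¹).mono' hm.aestronglyMeasurable
    (Filter.Eventually.of_forall fun ω => ?_)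
  rw [Real.norm_eq_abs, abs_of_nonneg (h0 ω), le_inv_mul_iff₀ hC]
  linarith [Real.add_one_le_exp (C * Y ω)]

theorem mgf_le_of_integral_exp_le [IsProbabilityMeasure P] {C K θ m : ℝ} (hC : 0 < C)
    (hθ : |θ| ≤ C / 2) {Y : Ω → ℝ} (hm : AEMeasurable Y P) (h0 : ∀ ω, 0 ≤ Y ω)
    (h_int : Integrable (fun ω => Real.exp (C * Y ω)) P)
    (hK : ∫ ω, Real.exp (C * Y ω) ∂P ≤ K) (hmean : ∫ ω, Y ω ∂P = m) :
    Integrable (fun ω => Real.exp (θ * Y ω)) P ∧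
      mgf Y P θ ≤ Real.exp (θ * m + θ ^ 2 * (8 / C ^ 2 * K)) := by
  have hY := integrable_of_integrable_exp hC hm h0 h_int
  have hr : Integrable (fun ω => 1 + θ * Y ω + θ ^ 2 * (8 / C ^ 2 * Real.exp (C * Y ω))) P :=
    ((integrable_const 1).add (hY.const_mul θ)).add ((h_int.const_mul _).const_mul _)
  have hi : Integrable (fun ω => Real.exp (θ * Y ω)) P := by
    refine hr.mono' (hm.const_mul θ).exp.aestronglyMeasurable
      (Filter.Eventually.of_forall fun ω => ?_)
    rw [Real.norm_eq_abs, abs_of_pos (Real.exp_pos _)]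
    exact exp_mul_le_of_nonneg hC hθ (h0 ω)
  refine ⟨hi, ?_⟩
  calc mgf Y P θ ≤ ∫ ω, (1 + θ * Y ω + θ ^ 2 * (8 / C ^ 2 * Real.exp (C * Y ω))) ∂P :=
        integral_mono hi hr fun ω => exp_mul_le_of_nonneg hC hθ (h0 ω)
    _ = 1 + θ * m + θ ^ 2 * (8 / C ^ 2 * ∫ ω, Real.exp (C * Y ω) ∂P) := by
        have h1 : Integrable (fun ω => 1 + θ * Y ω) P :=
          (integrable_const 1).add (hY.const_mul θ)
        rw [integral_add h1 ((h_int.const_mul _).const_mul _),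
          integral_add (integrable_const 1) (hY.const_mul θ),
          integral_const_mul, integral_const_mul, integral_const_mul, hmean]
        simp
    _ ≤ 1 + θ * m + θ ^ 2 * (8 / C ^ 2 * K) := by gcongr
    _ ≤ _ := by linarith [Real.add_one_le_exp (θ * m + θ ^ 2 * (8 / C ^ 2 * K))]

theorem integrable_exp_mul_sum_of_aemeasurable [IsFiniteMeasure P] {ι : Type*} {θ : ℝ}
    {X : ι → Ω → ℝ} (hind : iIndepFun X P) (hm : ∀ i, AEMeasurable (X i) P) (s : Finset ι)
    (h_int : ∀ i ∈ s, Integrable (fun ω => Real.exp (θ * X i ω)) P) :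
    Integrable (fun ω => Real.exp (θ * (∑ i ∈ s, X i) ω)) P := by
  classical
  induction s using Finset.induction_on with
  | empty => simp
  | insert i s hi ih =>
    rw [Finset.sum_insert hi]
    exact IndepFun.integrable_exp_mul_add (hind.indepFun_finsetSum_of_notMem₀ hm hi).symm
      (h_int i (Finset.mem_insert_self _ _)) (ih fun j hj => h_int j (Finset.mem_insert_of_mem hj))

/-- Exponential concentration of the empirical mean of independent nonnegative random variables
with a common mean and a common exponential moment. -/
theorem measure_abs_mean_sub_ge_le {C K δ : ℝ} (hC : 0 < C) (hK : 0 < K) (hδ : 0 < δ) :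
    ∃ c : ℝ, 0 < c ∧ ∀ {Ω : Type*} [MeasurableSpace Ω] (P : Measure Ω) [IsProbabilityMeasure P]
      (n : ℕ) (Y : Fin n → Ω → ℝ) (m : ℝ), (∀ k, AEMeasurable (Y k) P) → (∀ k ω, 0 ≤ Y k ω) →
      iIndepFun Y P → (∀ k, Integrable (fun ω => Real.exp (C * Y k ω)) P) →
      (∀ k, ∫ ω, Real.exp (C * Y k ω) ∂P ≤ K) → (∀ k, ∫ ω, Y k ω ∂P = m) →
      P {ω | δ < |(1 / (n : ℝ)) * ∑ k, Y k ω - m|} ≤ ENNReal.ofReal (2 * Real.exp (-(c * n))) := by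
  set V := 8 / C ^ 2 * K with hV
  have hV0 : 0 < V := by positivity
  -- The Chernoff exponent per sample is -θδ + θ²V, at most -θδ/2 once θV ≤ δ/2; the bound C/2 keeps
  -- the moment generating function finite.
  set θ := min (C / 2) (δ / (2 * V)) with hθdef
  have hθ0 : 0 < θ := lt_min (by positivity) (by positivity)
  have hθC : θ ≤ C / 2 := min_le_left _ _
  have hθV : θ * V ≤ δ / 2 := by
    calc θ * V ≤ δ / (2 * V) * V := by gcongr; exact min_le_right _ _
      _ = δ / 2 := by field_simp
  refine ⟨θ * δ / 2, by positivity, ?_⟩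
  intro Ω _ P _ n Y m hm h0 hind h_int hKk hmean
  -- For n = 0 the claimed bound is 2 and there is nothing to prove.
  rcases Nat.eq_zero_or_pos n with rfl | hn
  · refine prob_le_one.trans ?_
    simp
  have hn' : (0 : ℝ) < n := by exact_mod_cast hn
  have hmgf : ∀ θ' : ℝ, |θ'| ≤ C / 2 → mgf (∑ k, Y k) P θ' ≤
      Real.exp (n * (θ' * m + θ' ^ 2 * V)) := by
    intro θ' hθ'
    rw [hind.mgf_sum₀ hm]
    calc ∏ k, mgf (Y k) P θ' ≤ ∏ _k : Fin n, Real.exp (θ' * m + θ' ^ 2 * V) :=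
          Finset.prod_le_prod (fun k _ => mgf_nonneg) fun k _ =>
            (mgf_le_of_integral_exp_le hC hθ' (hm k) (h0 k) (h_int k) (hKk k) (hmean k)).2
      _ = _ := by simp [← Real.exp_nat_mul]
  have hintS : ∀ θ' : ℝ, |θ'| ≤ C / 2 →
      Integrable (fun ω => Real.exp (θ' * (∑ k, Y k) ω)) P := by
    intro θ' hθ'
    exact integrable_exp_mul_sum_of_aemeasurable hind hm _ fun k _ =>
        (mgf_le_of_integral_exp_le hC hθ' (hm k) (h0 k) (h_int k) (hKk k) (hmean k)).1
  have hθabs : |θ| ≤ C / 2 := by rwa [abs_of_pos hθ0]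
  have hθabs' : |-θ| ≤ C / 2 := by rwa [abs_neg]
  have hup := measure_ge_le_exp_mul_mgf (μ := P) (X := ∑ k, Y k) (n * (m + δ)) hθ0.le
    (hintS θ hθabs)
  have hlo := measure_le_le_exp_mul_mgf (μ := P) (X := ∑ k, Y k) (n * (m - δ)) (t := -θ)
    (by linarith) (hintS _ hθabs')
  have hbd : ∀ a b : ℝ, b ≤ Real.exp a → a ≤ -(θ * δ / 2 * n) → b ≤
      Real.exp (-(θ * δ / 2 * n)) := fun a b hb ha => hb.trans (Real.exp_le_exp.2 ha)
  have hkey : (n : ℝ) * (θ * (θ * V)) ≤ n * (θ * (δ / 2)) := by gcongr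
  have hup' : P.real {ω | n * (m + δ) ≤ (∑ k, Y k) ω} ≤ Real.exp (-(θ * δ / 2 * n)) := by
    refine hbd (-θ * (n * (m + δ)) + n * (θ * m + θ ^ 2 * V)) _ (hup.trans ?_) ?_
    · rw [Real.exp_add]; gcongr; exact hmgf θ hθabs
    · nlinarith
  have hlo' : P.real {ω | (∑ k, Y k) ω ≤ n * (m - δ)} ≤ Real.exp (-(θ * δ / 2 * n)) := by
    refine hbd (- -θ * (n * (m - δ)) + n * (-θ * m + (-θ) ^ 2 * V)) _ (hlo.trans ?_) ?_
    · rw [Real.exp_add]; gcongr; exact hmgf (-θ) hθabs'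
    · nlinarith
  have hsub : {ω | δ < |(1 / (n : ℝ)) * ∑ k, Y k ω - m|} ⊆
      {ω | n * (m + δ) ≤ (∑ k, Y k) ω} ∪ {ω | (∑ k, Y k) ω ≤ n * (m - δ)} := by
    intro ω hω
    simp only [Set.mem_ofPred_eq, Set.mem_union, Finset.sum_apply] at hω ⊢
    have e : (∑ k, Y k ω) = n * ((1 / (n : ℝ)) * ∑ k, Y k ω) := by field_simp
    rcases lt_abs.1 hω with h | h
    · left; rw [e]; gcongr; linarith
    · right; rw [e]; gcongr; linarith
  rw [← ofReal_measureReal]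
  refine ENNReal.ofReal_le_ofReal ?_
  calc P.real _ ≤ P.real ({ω | n * (m + δ) ≤ (∑ k, Y k) ω} ∪ {ω | (∑ k, Y k) ω ≤ n * (m - δ)}) :=
        measureReal_mono hsub
    _ ≤ _ := measureReal_union_le _ _
    _ ≤ _ := by linarith

end Chernoff

/-! ### Nets of subsets of the unit ball -/

section Nets

variable {E : Type*} [NormedAddCommGroup E] [NormedSpace ℝ E] [FiniteDimensional ℝ E]

/-- Volume comparison: the balls of radius ε/2 around the points are disjoint and lie in the ball of
radius 3/2. -/
theorem card_le_of_separated_of_norm_le_one {ε : ℝ} (hε : 0 < ε) (hε1 : ε ≤ 1) (s : Finset E)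
    (hs : ∀ c ∈ s, ‖c‖ ≤ 1) (h : ∀ c ∈ s, ∀ d ∈ s, c ≠ d → ε ≤ ‖c - d‖) :
    (s.card : ℝ) ≤ (3 / ε) ^ Module.finrank ℝ E := by
  borelize E
  let μ : Measure E := Measure.addHaar
  have hδ : 0 < ε / 2 := by positivity
  have hρ : (0 : ℝ) < 3 / 2 := by norm_num
  have D : Set.Pairwise (s : Set E) (Function.onFun Disjoint fun c => Metric.ball (c : E) (ε / 2)) := by
    rintro c hc d hd hcd
    apply Metric.ball_disjoint_ball
    rw [dist_eq_norm]
    linarith [h c hc d hd hcd]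
  have hsub : (⋃ c ∈ s, Metric.ball (c : E) (ε / 2)) ⊆ Metric.ball (0 : E) (3 / 2) := by
    refine Set.iUnion₂_subset fun x hx => ?_
    apply Metric.ball_subset_ball'
    rw [dist_zero_right]
    linarith [hs x hx]
  have I : (s.card : ENNReal) * ENNReal.ofReal ((ε / 2) ^ Module.finrank ℝ E) *
      μ (Metric.ball 0 1) ≤
        ENNReal.ofReal ((3 / 2) ^ Module.finrank ℝ E) * μ (Metric.ball 0 1) :=
    calc _ = μ (⋃ c ∈ s, Metric.ball (c : E) (ε / 2)) := by
          rw [measure_biUnion_finset D fun c _ => measurableSet_ball]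
          simp only [μ.addHaar_ball_of_pos _ hδ]
          simp only [Finset.sum_const, nsmul_eq_mul, mul_assoc]
      _ ≤ μ (Metric.ball (0 : E) (3 / 2)) := measure_mono hsub
      _ = _ := by simp only [μ.addHaar_ball_of_pos _ hρ]
  have J : (s.card : ENNReal) * ENNReal.ofReal ((ε / 2) ^ Module.finrank ℝ E) ≤
      ENNReal.ofReal ((3 / 2) ^ Module.finrank ℝ E) :=
    (ENNReal.mul_le_mul_iff_left (Metric.measure_ball_pos _ _ zero_lt_one).ne'
      measure_ball_lt_top.ne).1 I
  have K := ENNReal.toReal_le_of_le_ofReal (by positivity) J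
  rw [ENNReal.toReal_mul, ENNReal.toReal_natCast, ENNReal.toReal_ofReal (by positivity)] at K
  have h3 : (3 / ε : ℝ) = (3 / 2) / (ε / 2) := by field_simp
  rw [h3, div_pow, le_div_iff₀ (by positivity)]
  exact K

/-- A separated subset of maximal cardinality, which exists by the volume bound, is a net. The
points stay in S, because the estimates at net points are available only there. -/
theorem exists_net {ε : ℝ} (hε : 0 < ε) (hε1 : ε ≤ 1) (S : Set E) (hS : ∀ c ∈ S, ‖c‖ ≤ 1) :
    ∃ t : Finset E, (t : Set E) ⊆ S ∧ (t.card : ℝ) ≤ (3 / ε) ^ Module.finrank ℝ E ∧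
      ∀ h ∈ S, ∃ y ∈ t, ‖h - y‖ ≤ ε := by
  classical
  let p : ℕ → Prop := fun m => ∃ s : Finset E, (s : Set E) ⊆ S ∧
    (∀ c ∈ s, ∀ d ∈ s, c ≠ d → ε ≤ ‖c - d‖) ∧ s.card = m
  have hbound : ∀ m, p m → m ≤ ⌊(3 / ε) ^ Module.finrank ℝ E⌋₊ := by
    rintro m ⟨s, hs, hsep, rfl⟩
    exact Nat.le_floor (card_le_of_separated_of_norm_le_one hε hε1 s (fun c hc => hS c (hs hc)) hsep)
  have hp0 : p 0 := ⟨∅, by simp, by simp, rfl⟩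
  obtain ⟨s, hs, hsep, hcard⟩ := Nat.findGreatest_spec (P := p)
    (Nat.zero_le ⌊(3 / ε) ^ Module.finrank ℝ E⌋₊) hp0
  refine ⟨s, hs, card_le_of_separated_of_norm_le_one hε hε1 s (fun c hc => hS c (hs hc)) hsep, ?_⟩
  intro h hh
  by_contra! hcon
  have hns : h ∉ s := fun hmem => by
    have := hcon h hmem
    simp at this
    linarith
  have hp : p (s.card + 1) := by
    refine ⟨insert h s, ?_, ?_, Finset.card_insert_of_notMem hns⟩
    · rw [Finset.coe_insert]; exact Set.insert_subset hh hs
    · intro c hc d hd hcd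
      rcases Finset.mem_insert.1 hc with rfl | hc' <;> rcases Finset.mem_insert.1 hd with rfl | hd'
      · exact absurd rfl hcd
      · exact (hcon d hd').le
      · rw [norm_sub_rev]; exact (hcon c hc').le
      · exact hsep c hc' d hd' hcd
  have := Nat.le_findGreatest (hbound _ hp) hp
  omega

end Nets

/-! ### Moments of quaternionic Gaussian vectors -/

section Moments

variable {E : Type*} [NormedAddCommGroup E] [InnerProductSpace ℝ E]
    [FiniteDimensional ℝ E] [MeasurableSpace E] [BorelSpace E]

instance : IsGaussian (halfGaussian E) := by
  have : halfGaussian E = (stdGaussian E).map ((1 / 2 : ℝ) • ContinuousLinearMap.id ℝ E) := rfl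
  rw [this]
  infer_instance

theorem integral_inner_halfGaussian (s : E) : ∫ z, inner ℝ s z ∂(halfGaussian E) = 0 := by
  rw [halfGaussian, integral_map (by fun_prop) (Measurable.aestronglyMeasurable (by fun_prop))]
  simp only [real_inner_smul_right]
  rw [integral_const_mul]
  have := integral_strongDual_stdGaussian (innerSL ℝ s)
  simp only [innerSL_apply_apply] at this
  rw [this, mul_zero]

theorem integral_inner_sq_halfGaussian (s : E) :
    ∫ z, inner ℝ s z ^ 2 ∂(halfGaussian E) = ‖s‖ ^ 2 / 4 := by
  rw [halfGaussian, integral_map (by fun_prop) (Measurable.aestronglyMeasurable (by fun_prop))]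
  simp only [real_inner_smul_right, mul_pow]
  rw [integral_const_mul]
  have h1 := variance_dual_stdGaussian (innerSL ℝ s)
  rw [variance_eq_integral (by fun_prop), integral_strongDual_stdGaussian, innerSL_apply_norm] at h1
  simp only [innerSL_apply_apply, sub_zero] at h1
  rw [h1]
  ring

theorem integrable_norm_pow_halfGaussian (p : ℕ) :
    Integrable (fun z => ‖z‖ ^ p) (halfGaussian E) := by
  have h := (IsGaussian.memLp_id (halfGaussian E) p (by simp)).integrable_norm_pow'
  simpa using h

theorem integrable_inner_halfGaussian (s : E) :
    Integrable (fun z => inner ℝ s z) (halfGaussian E) := by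
  refine ((integrable_norm_pow_halfGaussian (E := E) 1).const_mul ‖s‖).mono'
    (Measurable.aestronglyMeasurable (by fun_prop)) (Filter.Eventually.of_forall fun z => ?_)
  simpa using abs_real_inner_le_norm s z

theorem integrable_inner_sq_halfGaussian (s : E) :
    Integrable (fun z => inner ℝ s z ^ 2) (halfGaussian E) := by
  refine ((integrable_norm_pow_halfGaussian (E := E) 2).const_mul (‖s‖ ^ 2)).mono'
    (Measurable.aestronglyMeasurable (by fun_prop)) (Filter.Eventually.of_forall fun z => ?_)
  rw [Real.norm_eq_abs, abs_pow, ← mul_pow]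
  gcongr
  exact abs_real_inner_le_norm s z

theorem integral_norm_sq_halfGaussian :
    ∫ z, ‖z‖ ^ 2 ∂(halfGaussian E) = Module.finrank ℝ E / 4 := by
  have h : ∀ z : E, ‖z‖ ^ 2 = ∑ i, inner ℝ (stdOrthonormalBasis ℝ E i) z ^ 2 := fun z =>
    ((stdOrthonormalBasis ℝ E).sum_sq_inner_right z).symm
  simp only [h]
  rw [integral_finsetSum _ fun i _ => integrable_inner_sq_halfGaussian _]
  simp only [integral_inner_sq_halfGaussian, OrthonormalBasis.norm_eq_one]
  simp [div_eq_mul_inv]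

theorem integral_norm_sq_quaternion : ∫ q, ‖q‖ ^ 2 ∂(halfGaussian ℍ[ℝ]) = 1 := by
  rw [integral_norm_sq_halfGaussian, Quaternion.finrank_eq_four]; norm_num

variable {d : ℕ}

/-- Integrals of functions of `a^* h`. -/
theorem integral_comp_qInner {F : ℍ[ℝ] → ℝ} (hF : Measurable F) (h : QVec d) :
    ∫ a, F (qInner a h) ∂(halfGaussian (QVec d)) = ∫ q, F (‖h‖ • q) ∂(halfGaussian ℍ[ℝ]) := by
  rw [← integral_map (measurable_qInner_left h).aemeasurable hF.aestronglyMeasurable,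
    map_qInner_halfGaussian, integral_map (by fun_prop) hF.aestronglyMeasurable]

theorem integrable_comp_qInner_iff {F : ℍ[ℝ] → ℝ} (hF : Measurable F) (h : QVec d) :
    Integrable (fun a => F (qInner a h)) (halfGaussian (QVec d)) ↔
      Integrable (fun q => F (‖h‖ • q)) (halfGaussian ℍ[ℝ]) := by
  rw [← Function.comp_def F, ← integrable_map_measure hF.aestronglyMeasurable
    (measurable_qInner_left h).aemeasurable, map_qInner_halfGaussian,
    integrable_map_measure hF.aestronglyMeasurable (by fun_prop)]
  rfl

theorem integral_norm_qInner_sq (h : QVec d) :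
    ∫ a, ‖qInner a h‖ ^ 2 ∂(halfGaussian (QVec d)) = ‖h‖ ^ 2 := by
  rw [integral_comp_qInner (F := fun q => ‖q‖ ^ 2) (by fun_prop)]
  simp only [norm_smul, norm_norm, mul_pow]
  rw [integral_const_mul, integral_norm_sq_quaternion, mul_one]

theorem integrable_norm_qInner_sq (h : QVec d) :
    Integrable (fun a => ‖qInner a h‖ ^ 2) (halfGaussian (QVec d)) := by
  rw [integrable_comp_qInner_iff (F := fun q => ‖q‖ ^ 2) (by fun_prop)]
  simp only [norm_smul, norm_norm, mul_pow]
  exact (integrable_norm_pow_halfGaussian 2).const_mul _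

/-- The joint law of `a^* x` and `a^* w` for a unit vector `x` and `x^* w = 0`. -/
theorem integral_comp_qInner_prod {F : ℍ[ℝ] × ℍ[ℝ] → ℝ} (hF : Measurable F) {x w : QVec d}
    (hx : ‖x‖ = 1) (hxw : qInner x w = 0)
    (h_int : Integrable (fun a => F (qInner a x, qInner a w)) (halfGaussian (QVec d))) :
    ∫ a, F (qInner a x, qInner a w) ∂(halfGaussian (QVec d)) =
      ∫ u, ∫ q, F (u, ‖w‖ • q) ∂(halfGaussian ℍ[ℝ]) ∂(halfGaussian ℍ[ℝ]) := by
  have hm : AEMeasurable (fun a => (qInner a x, qInner a w)) (halfGaussian (QVec d)) :=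
    ((measurable_qInner_left x).prodMk (measurable_qInner_left w)).aemeasurable
  have hmap := (indepFun_iff_map_prod_eq_prod_map_map (measurable_qInner_left x).aemeasurable
    (measurable_qInner_left w).aemeasurable).1 (indepFun_qInner hxw)
  rw [map_qInner_halfGaussian, map_qInner_halfGaussian, hx] at hmap
  simp only [one_smul, Measure.map_id'] at hmap
  have : IsProbabilityMeasure ((halfGaussian ℍ[ℝ]).map (‖w‖ • ·)) :=
    Measure.isProbabilityMeasure_map (by fun_prop)
  have h_int' : Integrable F ((halfGaussian ℍ[ℝ]).prod ((halfGaussian ℍ[ℝ]).map (‖w‖ • ·))) := by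
    rw [← hmap, integrable_map_measure hF.aestronglyMeasurable hm]
    exact h_int
  rw [← integral_map hm hF.aestronglyMeasurable, hmap, integral_prod _ h_int']
  refine integral_congr_ae (Filter.Eventually.of_forall fun u => ?_)
  simp only
  rw [integral_map (by fun_prop) (Measurable.aestronglyMeasurable (by fun_prop))]

end Moments

/-! ### Uniform concentration over subsets of the unit sphere -/

section Uniform

universe u

/-- For a unit vector h the law of a^*h is the same in all dimensions, and e^{C|q|²} is integrable
for some C > 0. Domination by |a^*h|² passes this moment to F, so the rate depends only on δ. -/
theorem exists_concentration {δ : ℝ} (hδ : 0 < δ) :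
    ∃ c : ℝ, 0 < c ∧ ∀ {d n : ℕ} {Ω : Type u} [MeasurableSpace Ω] {P : Measure Ω}
      [IsProbabilityMeasure P] {α : Fin n → Ω → QVec d}, IsQuaternionGaussian P α →
      ∀ {F : QVec d → ℝ} {h : QVec d}, Measurable F → ‖h‖ = 1 → (∀ a, 0 ≤ F a) →
      (∀ a, F a ≤ ‖qInner a h‖ ^ 2) →
      P {ω | δ < |(1 / (n : ℝ)) * ∑ k, F (α k ω) - ∫ a, F a ∂(halfGaussian (QVec d))|}
        ≤ ENNReal.ofReal (2 * Real.exp (-(c * n))) := by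
  obtain ⟨C, hC, hCint⟩ := IsGaussian.exists_integrable_exp_sq (halfGaussian ℍ[ℝ])
  have hK : 0 < ∫ q, Real.exp (C * ‖q‖ ^ 2) ∂(halfGaussian ℍ[ℝ]) := integral_exp_pos hCint
  obtain ⟨c, hc, H⟩ := measure_abs_mean_sub_ge_le.{u} hC hK hδ
  refine ⟨c, hc, ?_⟩
  intro d n Ω _ P _ α hα F h hF hh h0 hle
  have h_int : Integrable (fun a => Real.exp (C * ‖qInner a h‖ ^ 2)) (halfGaussian (QVec d)) := by
    rw [integrable_comp_qInner_iff (F := fun q => Real.exp (C * ‖q‖ ^ 2)) (by fun_prop), hh]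
    simpa using hCint
  have hval : ∫ a, Real.exp (C * ‖qInner a h‖ ^ 2) ∂(halfGaussian (QVec d)) =
      ∫ q, Real.exp (C * ‖q‖ ^ 2) ∂(halfGaussian ℍ[ℝ]) := by
    rw [integral_comp_qInner (F := fun q => Real.exp (C * ‖q‖ ^ 2)) (by fun_prop), hh]
    simp
  have hmF : Measurable fun a => Real.exp (C * F a) := by fun_prop
  have hintF : Integrable (fun a => Real.exp (C * F a)) (halfGaussian (QVec d)) := by
    refine h_int.mono' hmF.aestronglyMeasurable (Filter.Eventually.of_forall fun a => ?_)
    rw [Real.norm_eq_abs, abs_of_pos (Real.exp_pos _)]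
    have := hle a
    gcongr
  refine H P n (fun k ω => F (α k ω)) _ (fun k => hF.comp_aemeasurable (hα.aemeasurable k))
    (fun k ω => h0 _) ?_ ?_ ?_ ?_
  · exact hα.iIndepFun.comp (fun _ => F) fun _ => hF
  · intro k
    have := hintF
    rw [← (hα.hasLaw k).map_eq, integrable_map_measure hmF.aestronglyMeasurable
      (hα.aemeasurable k)] at this
    exact this
  · intro k
    have h1 := (hα.hasLaw k).integral_comp (f := fun a => Real.exp (C * F a))
      hmF.aestronglyMeasurable
    refine (h1.trans_le ?_)
    rw [← hval]
    refine integral_mono hintF h_int fun a => ?_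
    have := hle a
    simp only
    gcongr
  · intro k
    exact (hα.hasLaw k).integral_comp hF.aestronglyMeasurable

end Uniform

/-! ### Passage from net points to all directions. -/

section UniformConcentration

universe u

variable {d n : ℕ}

/-- At a maximiser v on the sphere with nearby net point y, M(v) ≤ 2M(y) + 2M(v-y) ≤ 4 + M(v)/8,
hence M(v) ≤ 5. -/
theorem gram_le_of_net {A : Fin n → QVec d} {t : Finset (QVec d)}
    (hnet : ∀ h : QVec d, ‖h‖ = 1 → ∃ y ∈ t, ‖h - y‖ ≤ 1 / 4)
    (ht : ∀ y ∈ t, (1 / (n : ℝ)) * ∑ k, ‖qInner (A k) y‖ ^ 2 ≤ 2) (h : QVec d) :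
    (1 / (n : ℝ)) * ∑ k, ‖qInner (A k) h‖ ^ 2 ≤ 5 * ‖h‖ ^ 2 := by
  have hn0 : (0 : ℝ) ≤ 1 / (n : ℝ) := by positivity
  set M : QVec d → ℝ := fun h => (1 / (n : ℝ)) * ∑ k, ‖qInner (A k) h‖ ^ 2 with hM
  have hcont : Continuous M := by
    refine continuous_const.mul (continuous_finsetSum _ fun k _ => ?_)
    exact ((qInnerCLM (A k)).continuous.norm).pow 2
  have hsmul : ∀ (r : ℝ) h, M (r • h) = r ^ 2 * M h := fun r h => by
    simp only [hM, qInner_smul_right, norm_smul, mul_pow, Real.norm_eq_abs, sq_abs,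
      ← Finset.mul_sum]
    ring
  have hadd : ∀ y z, M (y + z) ≤ 2 * M y + 2 * M z := fun y z => by
    simp only [hM]
    rw [mul_left_comm (2 : ℝ) (1 / (n : ℝ)), mul_left_comm (2 : ℝ) (1 / (n : ℝ)), ← mul_add,
      Finset.mul_sum (a := (2 : ℝ)), Finset.mul_sum (a := (2 : ℝ)), ← Finset.sum_add_distrib]
    refine mul_le_mul_of_nonneg_left (Finset.sum_le_sum fun k _ => ?_) hn0
    rw [qInner_add_right]
    have h1 := norm_add_le (qInner (A k) y) (qInner (A k) z)
    nlinarith [sq_nonneg (‖qInner (A k) y‖ - ‖qInner (A k) z‖), norm_nonneg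
      (qInner (A k) y + qInner (A k) z)]
  change M h ≤ _
  rcases eq_or_ne h 0 with rfl | hh
  · simp [hM, qInner_zero_right]
  have hunit : ∀ z : QVec d, z ≠ 0 → ‖‖z‖⁻¹ • z‖ = 1 := fun z hz => by
    simp [norm_smul, norm_ne_zero_iff.2 hz]
  have hscale : ∀ z : QVec d, z ≠ 0 → M z = ‖z‖ ^ 2 * M (‖z‖⁻¹ • z) := fun z hz => by
    have := norm_ne_zero_iff.2 hz
    rw [hsmul]; field_simp
  have : ProperSpace (QVec d) := FiniteDimensional.proper ℝ _
  obtain ⟨v, hv, hmax⟩ := (isCompact_sphere (0 : QVec d) 1).exists_isMaxOn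
    ⟨‖h‖⁻¹ • h, by simpa using hunit h hh⟩ hcont.continuousOn
  have hv1 : ‖v‖ = 1 := by simpa using hv
  have hle : ∀ z, M z ≤ ‖z‖ ^ 2 * M v := by
    intro z
    rcases eq_or_ne z 0 with rfl | hz
    · simp [hM, qInner_zero_right]
    · rw [hscale z hz]
      have : M (‖z‖⁻¹ • z) ≤ M v := hmax (by simpa using hunit z hz)
      gcongr
  obtain ⟨y, hy, hvy⟩ := hnet v hv1
  have h1 : M v ≤ 2 * M y + 2 * M (v - y) := by
    have := hadd y (v - y)
    rwa [add_sub_cancel] at this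
  have h2 : M y ≤ 2 := ht y hy
  have h3 := hle (v - y)
  have hM0 : 0 ≤ M v := by simp only [hM]; positivity
  have h4 : ‖v - y‖ ^ 2 * M v ≤ (1 / 4) ^ 2 * M v := by gcongr
  have h5 : M v ≤ 5 := by linarith
  calc M h ≤ ‖h‖ ^ 2 * M v := hle h
    _ ≤ ‖h‖ ^ 2 * 5 := by gcongr
    _ = _ := by ring

/-- Young's inequality replaces the product b(s+s') by squares, so empirical and true Gram forms
control it. With b = |a^*(h-y)| and ‖h-y‖ ≤ ε all terms have order ε. -/
theorem abs_sq_sub_sq_le_of_abs_sub_le {g g' b s s' ε : ℝ} (hε : 0 < ε) (hg : 0 ≤ g)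
    (hg' : 0 ≤ g') (hgs : g ≤ s) (hgs' : g' ≤ s') (hb : |g - g'| ≤ b) :
    |g ^ 2 - g' ^ 2| ≤ b ^ 2 / (2 * ε) + ε * (s ^ 2 + s' ^ 2) := by
  have hb0 : 0 ≤ b := (abs_nonneg _).trans hb
  have h1 : |g ^ 2 - g' ^ 2| ≤ b * (s + s') := by
    rw [sq_sub_sq, abs_mul, mul_comm, abs_of_nonneg (add_nonneg hg hg')]
    gcongr
  have h2 : b * (s + s') ≤ b ^ 2 / (2 * ε) + ε * (s ^ 2 + s' ^ 2) := by
    have h3 : b ^ 2 / (2 * ε) + ε * (s ^ 2 + s' ^ 2) - b * (s + s') =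
        ((b - ε * (s + s')) ^ 2 + ε ^ 2 * (s - s') ^ 2) / (2 * ε) := by
      field_simp; ring
    have : 0 ≤ ((b - ε * (s + s')) ^ 2 + ε ^ 2 * (s - s') ^ 2) / (2 * ε) := by positivity
    linarith
  exact h1.trans h2

/-- The passage from a net to the whole set. -/
theorem abs_mean_sub_integral_le_of_net {δ ε : ℝ} (hε : 0 < ε) (hεδ : 30 * ε ≤ δ)
    {S : Set (QVec d)} (hS : ∀ h ∈ S, ‖h‖ = 1) {G : QVec d → QVec d → ℝ}
    (hGm : ∀ h ∈ S, Measurable fun a => G a h) (hG0 : ∀ a, ∀ h ∈ S, 0 ≤ G a h)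
    (hGle : ∀ a, ∀ h ∈ S, G a h ≤ ‖qInner a h‖)
    (hGlip : ∀ a, ∀ h ∈ S, ∀ y ∈ S, |G a h - G a y| ≤ ‖qInner a (h - y)‖)
    {t : Finset (QVec d)} (htS : (t : Set (QVec d)) ⊆ S)
    (hnet : ∀ h ∈ S, ∃ y ∈ t, ‖h - y‖ ≤ ε) {A : Fin n → QVec d}
    (hA : ∀ h, (1 / (n : ℝ)) * ∑ k, ‖qInner (A k) h‖ ^ 2 ≤ 5 * ‖h‖ ^ 2)
    (ht : ∀ y ∈ t, |(1 / (n : ℝ)) * ∑ k, G (A k) y ^ 2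
      - ∫ a, G a y ^ 2 ∂(halfGaussian (QVec d))| ≤ δ / 2) {h : QVec d} (hh : h ∈ S) :
    |(1 / (n : ℝ)) * ∑ k, G (A k) h ^ 2 - ∫ a, G a h ^ 2 ∂(halfGaussian (QVec d))| ≤ δ := by
  have hn0 : (0 : ℝ) ≤ 1 / (n : ℝ) := by positivity
  obtain ⟨y, hy, hhy⟩ := hnet h hh
  have hyS := htS hy
  have hpt : ∀ a, |G a h ^ 2 - G a y ^ 2| ≤
      ‖qInner a (h - y)‖ ^ 2 / (2 * ε) + ε * (‖qInner a h‖ ^ 2 + ‖qInner a y‖ ^ 2) := fun a =>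
    abs_sq_sub_sq_le_of_abs_sub_le hε (hG0 a h hh) (hG0 a y hyS) (hGle a h hh) (hGle a y hyS)
      (hGlip a h hh y hyS)
  have hd2 : ‖h - y‖ ^ 2 / (2 * ε) ≤ ε / 2 := by
    rw [div_le_iff₀ (by positivity)]
    have : ‖h - y‖ ^ 2 ≤ ε ^ 2 := by gcongr
    linarith
  -- empirical mean
  have h1 : |(1 / (n : ℝ)) * ∑ k, G (A k) h ^ 2 - (1 / (n : ℝ)) * ∑ k, G (A k) y ^ 2|
      ≤ 25 / 2 * ε := by
    rw [← mul_sub, ← Finset.sum_sub_distrib, abs_mul, abs_of_nonneg hn0]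
    calc (1 / (n : ℝ)) * |∑ k, (G (A k) h ^ 2 - G (A k) y ^ 2)|
        ≤ (1 / (n : ℝ)) * ∑ k, (‖qInner (A k) (h - y)‖ ^ 2 / (2 * ε)
          + ε * (‖qInner (A k) h‖ ^ 2 + ‖qInner (A k) y‖ ^ 2)) := by
          refine mul_le_mul_of_nonneg_left ((Finset.abs_sum_le_sum_abs _ _).trans
            (Finset.sum_le_sum fun k _ => hpt _)) hn0
      _ = ((1 / (n : ℝ)) * ∑ k, ‖qInner (A k) (h - y)‖ ^ 2) / (2 * ε)
          + ε * ((1 / (n : ℝ)) * ∑ k, ‖qInner (A k) h‖ ^ 2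
            + (1 / (n : ℝ)) * ∑ k, ‖qInner (A k) y‖ ^ 2) := by
          rw [Finset.sum_add_distrib, ← Finset.sum_div, ← Finset.mul_sum, Finset.sum_add_distrib]
          ring
      _ ≤ (5 * ‖h - y‖ ^ 2) / (2 * ε) + ε * (5 * ‖h‖ ^ 2 + 5 * ‖y‖ ^ 2) := by
          exact add_le_add (div_le_div_of_nonneg_right (hA _) (by positivity))
            (mul_le_mul_of_nonneg_left (add_le_add (hA _) (hA _)) hε.le)
      _ = 5 * (‖h - y‖ ^ 2 / (2 * ε)) + ε * 10 := by rw [hS h hh, hS y hyS]; ring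
      _ ≤ 25 / 2 * ε := by linarith
  -- expectation
  have h_int : ∀ z ∈ S, Integrable (fun a => G a z ^ 2) (halfGaussian (QVec d)) := fun z hz => by
    refine (integrable_norm_qInner_sq z).mono' ((hGm z hz).pow_const 2).aestronglyMeasurable
      (Filter.Eventually.of_forall fun a => ?_)
    rw [Real.norm_eq_abs, abs_of_nonneg (sq_nonneg _)]
    have := hG0 a z hz
    have := hGle a z hz
    gcongr
  have h2 : |∫ a, G a h ^ 2 ∂(halfGaussian (QVec d)) - ∫ a, G a y ^ 2 ∂(halfGaussian (QVec d))|
      ≤ 5 / 2 * ε := by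
    rw [← integral_sub (h_int h hh) (h_int y hyS)]
    have i1 := (integrable_norm_qInner_sq (h - y)).div_const (2 * ε)
    have i2 : Integrable (fun a => ‖qInner a h‖ ^ 2 + ‖qInner a y‖ ^ 2) (halfGaussian (QVec d)) :=
      (integrable_norm_qInner_sq h).add (integrable_norm_qInner_sq y)
    calc |∫ a, (G a h ^ 2 - G a y ^ 2) ∂(halfGaussian (QVec d))|
        ≤ ∫ a, |G a h ^ 2 - G a y ^ 2| ∂(halfGaussian (QVec d)) := abs_integral_le_integral_abs
      _ ≤ ∫ a, (‖qInner a (h - y)‖ ^ 2 / (2 * ε)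
          + ε * (‖qInner a h‖ ^ 2 + ‖qInner a y‖ ^ 2)) ∂(halfGaussian (QVec d)) :=
          integral_mono ((h_int h hh).sub (h_int y hyS)).abs (i1.add (i2.const_mul ε)) hpt
      _ = ‖h - y‖ ^ 2 / (2 * ε) + ε * (‖h‖ ^ 2 + ‖y‖ ^ 2) := by
          rw [integral_add i1 (i2.const_mul ε), integral_div, integral_const_mul,
            integral_add (integrable_norm_qInner_sq h) (integrable_norm_qInner_sq y)]
          simp only [integral_norm_qInner_sq]
      _ ≤ 5 / 2 * ε := by rw [hS h hh, hS y hyS]; linarith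
  have h3 := ht y hy
  -- The net error is (25/2 + 5/2)ε = 15ε ≤ δ/2.
  rw [abs_le] at h1 h2 h3 ⊢
  constructor <;> linarith [h1.1, h1.2, h2.1, h2.2, h3.1, h3.2]

theorem finrank_qVec (d : ℕ) : Module.finrank ℝ (QVec d) = 4 * d := by
  rw [(WithLp.linearEquiv 2 ℝ (Fin d → ℍ[ℝ])).finrank_eq, Module.finrank_pi_fintype]
  simp [Quaternion.finrank_eq_four, mul_comm]

/-- Uniform law of large numbers with exponential probability for the squares of a family of
functions that is dominated by `|a^* h|` and Lipschitz in `h` in the corresponding sense. -/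
theorem exists_uniform_concentration {δ : ℝ} (hδ : 0 < δ) :
    ∃ C c₁ c₂ : ℝ, 0 < C ∧ 0 < c₁ ∧ 0 < c₂ ∧ ∀ {d n : ℕ} {Ω : Type u} [MeasurableSpace Ω]
      {P : Measure Ω} [IsProbabilityMeasure P] {α : Fin n → Ω → QVec d},
      C * (d : ℝ) ≤ (n : ℝ) → IsQuaternionGaussian P α →
      ∀ {S : Set (QVec d)} {G : QVec d → QVec d → ℝ}, (∀ h ∈ S, ‖h‖ = 1) →
      (∀ h ∈ S, Measurable fun a => G a h) → (∀ a, ∀ h ∈ S, 0 ≤ G a h) →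
      (∀ a, ∀ h ∈ S, G a h ≤ ‖qInner a h‖) →
      (∀ a, ∀ h ∈ S, ∀ y ∈ S, |G a h - G a y| ≤ ‖qInner a (h - y)‖) →
      P {ω | ¬ ∀ h ∈ S, |(1 / (n : ℝ)) * ∑ k, G (α k ω) h ^ 2
        - ∫ a, G a h ^ 2 ∂(halfGaussian (QVec d))| ≤ δ}
        ≤ ENNReal.ofReal (c₁ * Real.exp (-(c₂ * n))) := by
  obtain ⟨ca, hca, Ha⟩ := exists_concentration.{u} (half_pos hδ)
  obtain ⟨cb, hcb, Hb⟩ := exists_concentration.{u} one_pos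
  set c := min ca cb with hc
  have hc0 : 0 < c := lt_min hca hcb
  set ε := min (δ / 30) (1 / 4) with hεdef
  have hε : 0 < ε := lt_min (by positivity) (by norm_num)
  have hε4 : ε ≤ 1 / 4 := min_le_right _ _
  have hεδ : 30 * ε ≤ δ := by
    have : ε ≤ δ / 30 := min_le_left _ _
    linarith
  have h3ε : 1 < 3 / ε := by rw [lt_div_iff₀ hε]; linarith
  set L := Real.log (3 / ε) with hL
  have hL0 : 0 < L := Real.log_pos h3ε
  -- A net in real dimension 4d has at most e^{4Ld} points; n ≥ 8Ld/c makes this at most e^{cn/2},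
  -- leaving half of the rate. Two union bounds with factor 2 give the constant 4.
  refine ⟨8 * L / c, 4, c / 2, by positivity, by norm_num, by positivity, ?_⟩
  intro d n Ω _ P _ α hdn hα S G hS hGm hG0 hGle hGlip
  -- Two nets are needed: one inside S for G, and one of the whole sphere for the Gram bound, since
  -- differences h - y leave S.
  obtain ⟨t, htS, htcard, htnet⟩ := exists_net hε (hε4.trans (by norm_num)) S
    fun h hh => (hS h hh).le
  obtain ⟨t₀, ht₀S, ht₀card, ht₀net⟩ := exists_net hε (hε4.trans (by norm_num))
    {h : QVec d | ‖h‖ = 1} fun h hh => le_of_eq hh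
  -- the number of points of the nets
  have hcardle : (3 / ε) ^ Module.finrank ℝ (QVec d) * Real.exp (-(c * n)) ≤
      Real.exp (-(c / 2 * n)) := by
    rw [finrank_qVec, ← Real.exp_log (show (0 : ℝ) < 3 / ε by positivity), ← hL,
      ← Real.exp_nat_mul, ← Real.exp_add, Real.exp_le_exp]
    have h1 : 8 * L * d ≤ c * n := by
      rw [div_mul_eq_mul_div, div_le_iff₀ hc0] at hdn
      linarith
    push_cast
    linarith
  have hexp : ∀ c', c ≤ c' → Real.exp (-(c' * n)) ≤ Real.exp (-(c * n)) := fun c' hc' => by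
    have : (0 : ℝ) ≤ n := Nat.cast_nonneg n
    gcongr
  have hunion : ∀ (s : Finset (QVec d)) (B : QVec d → Set Ω) (c' : ℝ), c ≤ c' →
      (s.card : ℝ) ≤ (3 / ε) ^ Module.finrank ℝ (QVec d) →
      (∀ y ∈ s, P (B y) ≤ ENNReal.ofReal (2 * Real.exp (-(c' * n)))) →
      P (⋃ y ∈ s, B y) ≤ ENNReal.ofReal (2 * Real.exp (-(c / 2 * n))) := by
    intro s B c' hc' hcard hB
    calc P (⋃ y ∈ s, B y) ≤ ∑ y ∈ s, P (B y) := measure_biUnion_finset_le _ _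
      _ ≤ ∑ _y ∈ s, ENNReal.ofReal (2 * Real.exp (-(c' * n))) := Finset.sum_le_sum hB
      _ = ENNReal.ofReal (s.card * (2 * Real.exp (-(c' * n)))) := by
          rw [Finset.sum_const, nsmul_eq_mul, ENNReal.ofReal_mul (Nat.cast_nonneg s.card),
            ENNReal.ofReal_natCast]
      _ ≤ _ := by
          refine ENNReal.ofReal_le_ofReal ?_
          calc (s.card : ℝ) * (2 * Real.exp (-(c' * n)))
              ≤ (3 / ε) ^ Module.finrank ℝ (QVec d) * (2 * Real.exp (-(c * n))) := by
                have := hexp c' hc'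
                gcongr
            _ = 2 * ((3 / ε) ^ Module.finrank ℝ (QVec d) * Real.exp (-(c * n))) := by ring
            _ ≤ _ := by gcongr
  have hb1 := hunion t (fun y => {ω | δ / 2 < |(1 / (n : ℝ)) * ∑ k, G (α k ω) y ^ 2
      - ∫ a, G a y ^ 2 ∂(halfGaussian (QVec d))|}) ca (min_le_left _ _) htcard fun y hy => by
    have hyS := htS hy
    refine Ha hα (F := fun a => G a y ^ 2) (h := y) ((hGm y hyS).pow_const 2) (hS y hyS)
      (fun a => sq_nonneg _) fun a => ?_
    have := hG0 a y hyS
    have := hGle a y hyS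
    gcongr
  have hb2 := hunion t₀ (fun y => {ω | 1 < |(1 / (n : ℝ)) * ∑ k, ‖qInner (α k ω) y‖ ^ 2
      - ∫ a, ‖qInner a y‖ ^ 2 ∂(halfGaussian (QVec d))|}) cb (min_le_right _ _) ht₀card
    fun y hy => Hb hα (F := fun a => ‖qInner a y‖ ^ 2) (h := y)
      ((measurable_qInner_left y).norm.pow_const 2) (ht₀S hy) (fun a => sq_nonneg _)
      fun a => le_rfl
  refine (measure_mono ?_).trans ((measure_union_le _ _).trans ((add_le_add hb1 hb2).trans ?_))
  · intro ω hω
    by_contra hnot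
    simp only [Set.mem_union, Set.mem_iUnion, Set.mem_ofPred_eq, not_or, not_exists,
      not_lt] at hnot
    obtain ⟨hn1, hn2⟩ := hnot
    refine hω fun h hh => ?_
    refine abs_mean_sub_integral_le_of_net hε hεδ hS hGm hG0 hGle hGlip htS htnet
      (A := fun k => α k ω) ?_ (fun y hy => hn1 y hy) hh
    refine gram_le_of_net (t := t₀) (fun h hh => ?_) fun y hy => ?_
    · obtain ⟨y, hy, hhy⟩ := ht₀net h hh
      exact ⟨y, hy, hhy.trans hε4⟩
    · have h1 := hn2 y hy
      have hy1 : ‖y‖ = 1 := ht₀S hy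
      rw [integral_norm_qInner_sq, hy1] at h1
      linarith [(abs_le.1 h1).2]
  · rw [← ENNReal.ofReal_add (by positivity) (by positivity)]
    exact ENNReal.ofReal_le_ofReal (by linarith)

end UniformConcentration

/-! ### Expectations -/

section Expectations

/-- The characteristic function at 1 has modulus e^{-1/8} < 1, so the law is not a Dirac mass, and a
nondegenerate Gaussian has no atoms. -/
theorem halfGaussian_quaternion_singleton_zero : halfGaussian ℍ[ℝ] {0} = 0 := by
  have h : ∀ x, halfGaussian ℍ[ℝ] ≠ Measure.dirac x := by
    intro x hx
    have h1 := charFun_halfGaussian (1 : ℍ[ℝ])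
    rw [hx, charFun_dirac] at h1
    have h2 := congrArg norm h1
    rw [Complex.norm_exp_ofReal_mul_I, norm_one, Complex.norm_exp] at h2
    norm_num at h2
    have h3 : Real.exp (-(1 / 8)) < 1 := by
      rw [← Real.exp_zero]; exact Real.exp_lt_exp.2 (by norm_num)
    exact h3.ne h2.symm
  have := IsGaussian.nullSingletonClass h
  exact measure_singleton 0

theorem exists_halfGaussian_ball_le {ε : ℝ} (hε : 0 < ε) :
    ∃ τ : ℝ, 0 < τ ∧ τ ≤ 1 ∧ (halfGaussian ℍ[ℝ]).real (Metric.ball 0 τ) ≤ ε := by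
  obtain ⟨U, hU, hUo, hUlt⟩ := Set.exists_isOpen_lt_of_lt ({0} : Set ℍ[ℝ]) (ENNReal.ofReal ε)
    (μ := halfGaussian ℍ[ℝ])
    (by rw [halfGaussian_quaternion_singleton_zero]; exact ENNReal.ofReal_pos.2 hε)
  obtain ⟨τ, hτ, hball⟩ := Metric.isOpen_iff.1 hUo 0 (hU rfl)
  refine ⟨min τ 1, lt_min hτ one_pos, min_le_right _ _, ?_⟩
  refine ENNReal.toReal_le_of_le_ofReal hε.le ?_
  exact (measure_mono ((Metric.ball_subset_ball (min_le_left _ _)).trans hball)).trans hUlt.le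

/-- `∫ e^{-|q|²}` for a quaternionic Gaussian variable. -/
def expWeightMean : ℝ := ∫ q, Real.exp (-‖q‖ ^ 2) ∂(halfGaussian ℍ[ℝ])

/-- The spectral gap `∫ e^{-|q|²} (1 - |q|²)` of the expected initialization matrix. -/
def spectralGap : ℝ :=
  expWeightMean - ∫ q, Real.exp (-‖q‖ ^ 2) * ‖q‖ ^ 2 ∂(halfGaussian ℍ[ℝ])

theorem integrable_mul_norm_sq_of_le_one {b : ℍ[ℝ] → ℝ} (hb : Measurable b) (hb0 : ∀ q, 0 ≤ b q)
    (hb1 : ∀ q, b q ≤ 1) : Integrable (fun q => b q * ‖q‖ ^ 2) (halfGaussian ℍ[ℝ]) := by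
  refine (integrable_norm_pow_halfGaussian 2).mono'
    (Measurable.aestronglyMeasurable (by fun_prop)) (Filter.Eventually.of_forall fun q => ?_)
  rw [Real.norm_eq_abs, abs_of_nonneg (mul_nonneg (hb0 q) (sq_nonneg _))]
  exact mul_le_of_le_one_left (sq_nonneg _) (hb1 q)

theorem integrable_of_le_one {b : ℍ[ℝ] → ℝ} (hb : Measurable b) (hb0 : ∀ q, 0 ≤ b q)
    (hb1 : ∀ q, b q ≤ 1) : Integrable b (halfGaussian ℍ[ℝ]) :=
  (integrable_const (1 : ℝ)).mono' hb.aestronglyMeasurable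
    (Filter.Eventually.of_forall fun q => by
      rw [Real.norm_eq_abs, abs_of_nonneg (hb0 q)]; exact hb1 q)

theorem exp_neg_norm_sq_le_one (q : ℍ[ℝ]) : Real.exp (-‖q‖ ^ 2) ≤ 1 :=
  Real.exp_le_one_iff.2 (by simp)

/-- As |q|² has mean 1, subtracting e^{-1}(1-|q|²) changes nothing, and the integrand becomes
(e^{-|q|²}-e^{-1})(1-|q|²), a product of factors of equal sign that vanishes only on |q| = 1. -/
theorem spectralGap_pos : 0 < spectralGap := by
  set f : ℍ[ℝ] → ℝ := fun q => (Real.exp (-‖q‖ ^ 2) - Real.exp (-1)) * (1 - ‖q‖ ^ 2) with hf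
  have hm : Measurable fun q : ℍ[ℝ] => Real.exp (-‖q‖ ^ 2) := by fun_prop
  have i1 := integrable_of_le_one hm (fun q => (Real.exp_pos _).le) exp_neg_norm_sq_le_one
  have i2 := integrable_mul_norm_sq_of_le_one hm (fun q => (Real.exp_pos _).le)
    exp_neg_norm_sq_le_one
  have i3 := integrable_norm_pow_halfGaussian (E := ℍ[ℝ]) 2
  have i4 : Integrable (fun q : ℍ[ℝ] => Real.exp (-1) * (1 - ‖q‖ ^ 2)) (halfGaussian ℍ[ℝ]) :=
    ((integrable_const 1).sub i3).const_mul _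
  have i12 : Integrable (fun q : ℍ[ℝ] => Real.exp (-‖q‖ ^ 2) - Real.exp (-‖q‖ ^ 2) * ‖q‖ ^ 2)
    (halfGaussian ℍ[ℝ]) := i1.sub i2
  have hfe : f = fun q => (Real.exp (-‖q‖ ^ 2) - Real.exp (-‖q‖ ^ 2) * ‖q‖ ^ 2)
      - Real.exp (-1) * (1 - ‖q‖ ^ 2) := by
    funext q; simp only [hf]; ring
  have hfi : Integrable f (halfGaussian ℍ[ℝ]) := by rw [hfe]; exact i12.sub i4
  have hgap : spectralGap = ∫ q, f q ∂(halfGaussian ℍ[ℝ]) := by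
    rw [hfe, integral_sub i12 i4, integral_sub i1 i2, integral_const_mul,
      integral_sub (integrable_const 1) i3, integral_norm_sq_quaternion]
    simp [spectralGap, expWeightMean]
  have hpos : ∀ q : ℍ[ℝ], ‖q‖ ^ 2 ≠ 1 → 0 < f q := by
    intro q hq
    rcases lt_or_gt_of_ne hq with h | h
    · exact mul_pos (sub_pos.2 (Real.exp_lt_exp.2 (by linarith))) (by linarith)
    · exact mul_pos_of_neg_of_neg (sub_neg.2 (Real.exp_lt_exp.2 (by linarith))) (by linarith)
  have hnn : ∀ q, 0 ≤ f q := by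
    intro q
    by_cases hq : ‖q‖ ^ 2 = 1
    · simp [hf, hq]
    · exact (hpos q hq).le
  rw [hgap]
  refine (integral_nonneg hnn).lt_of_ne fun h0 => ?_
  have hae := (integral_eq_zero_iff_of_nonneg hnn hfi).1 h0.symm
  have hae1 : ∀ᵐ q ∂(halfGaussian ℍ[ℝ]), ‖q‖ ^ 2 = 1 := by
    filter_upwards [hae] with q hq
    by_contra hne
    exact (hpos q hne).ne' hq
  -- then `⟨1, q⟩` would be bounded by one almost surely, in contrast to its Gaussian law
  have hlaw : (halfGaussian ℍ[ℝ]).map (fun q => inner ℝ (1 : ℍ[ℝ]) q) = gaussianReal 0 (1 / 4) := by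
    have : IsProbabilityMeasure ((halfGaussian ℍ[ℝ]).map (fun q => inner ℝ (1 : ℍ[ℝ]) q)) :=
      Measure.isProbabilityMeasure_map (by fun_prop)
    refine Measure.ext_of_charFun (funext fun t => ?_)
    rw [charFun_apply_real, integral_map (by fun_prop)
      (Measurable.aestronglyMeasurable (by fun_prop)), charFun_gaussianReal]
    have := charFun_halfGaussian (t • (1 : ℍ[ℝ]))
    rw [charFun_apply, norm_smul, norm_one] at this
    simp only [real_inner_smul_right, real_inner_comm (1 : ℍ[ℝ])] at this
    push_cast at this
    rw [this]
    congr 1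
    simp only [Real.norm_eq_abs, mul_one, ← Complex.ofReal_pow, sq_abs]
    push_cast
    ring
  have h1 : gaussianReal 0 (1 / 4) (Set.Ioi 1) = 0 := by
    rw [← hlaw, Measure.map_apply (by fun_prop) measurableSet_Ioi]
    refine measure_mono_null (fun q hq => ?_) hae1
    simp only [Set.mem_preimage, Set.mem_Ioi] at hq
    change ¬ ‖q‖ ^ 2 = 1
    have := real_inner_le_norm (1 : ℍ[ℝ]) q
    rw [norm_one, one_mul] at this
    nlinarith
  have h2 := gaussianReal_absolutelyContinuous' 0 (v := 1 / 4) (by norm_num) h1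
  simp at h2

variable {d : ℕ} {x h : QVec d}

theorem qInner_eq_add (a x h : QVec d) :
    qInner a h = qInner a x * qInner x h + qInner a (h - rightMul x (qInner x h)) := by
  rw [qInner_sub_right, qInner_rightMul_right]; abel

theorem qInner_orthogonal_part (hx : ‖x‖ = 1) :
    qInner x (h - rightMul x (qInner x h)) = 0 := by
  rw [qInner_sub_right, qInner_rightMul_right, qInner_self, hx]; simp

theorem norm_orthogonal_part_sq (hx : ‖x‖ = 1) (hh : ‖h‖ = 1) :
    ‖h - rightMul x (qInner x h)‖ ^ 2 = 1 - ‖qInner x h‖ ^ 2 := by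
  rw [norm_sub_sq_real, norm_rightMul, hx, hh, real_inner_comm, real_inner_rightMul_left,
    Quaternion.star_mul_self, Quaternion.re_coe, Quaternion.normSq_eq_norm_mul_self]
  ring

theorem integral_norm_add_smul_sq (p : ℍ[ℝ]) (s : ℝ) :
    ∫ q, ‖p + s • q‖ ^ 2 ∂(halfGaussian ℍ[ℝ]) = ‖p‖ ^ 2 + s ^ 2 := by
  have e : ∀ q : ℍ[ℝ], ‖p + s • q‖ ^ 2 = ‖p‖ ^ 2 + 2 * s * inner ℝ p q + s ^ 2 * ‖q‖ ^ 2 := by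
    intro q
    rw [norm_add_sq_real, real_inner_smul_right, norm_smul, mul_pow, Real.norm_eq_abs, sq_abs]
    ring
  have i1 : Integrable (fun q => ‖p‖ ^ 2 + 2 * s * inner ℝ p q) (halfGaussian ℍ[ℝ]) :=
    (integrable_const _).add ((integrable_inner_halfGaussian p).const_mul _)
  simp only [e]
  rw [integral_add i1 ((integrable_norm_pow_halfGaussian 2).const_mul _),
    integral_add (integrable_const _) ((integrable_inner_halfGaussian p).const_mul _),
    integral_const_mul, integral_const_mul, integral_inner_halfGaussian,
    integral_norm_sq_quaternion]
  simp

/-- Second moments of `a^* h` weighted by a function of `a^* x`. -/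
theorem integral_weight_mul_norm_qInner_sq (hx : ‖x‖ = 1) (hh : ‖h‖ = 1) {b : ℍ[ℝ] → ℝ}
    (hb : Measurable b) (hb0 : ∀ q, 0 ≤ b q) (hb1 : ∀ q, b q ≤ 1) :
    ∫ a, b (qInner a x) * ‖qInner a h‖ ^ 2 ∂(halfGaussian (QVec d)) =
      ‖qInner x h‖ ^ 2 * ∫ q, b q * ‖q‖ ^ 2 ∂(halfGaussian ℍ[ℝ])
        + (1 - ‖qInner x h‖ ^ 2) * ∫ q, b q ∂(halfGaussian ℍ[ℝ]) := by
  have hF : Measurable fun p : ℍ[ℝ] × ℍ[ℝ] => b p.1 * ‖p.1 * qInner x h + p.2‖ ^ 2 := by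
    have h1 : Continuous fun p : ℍ[ℝ] × ℍ[ℝ] => ‖p.1 * qInner x h + p.2‖ ^ 2 := by fun_prop
    have h2 : Measurable fun p : ℍ[ℝ] × ℍ[ℝ] => ‖p.1 * qInner x h + p.2‖ ^ 2 := by
      exact h1.measurable
    exact (hb.comp measurable_fst).mul h2
  have hmq := measurable_qInner_left h
  have hmx := measurable_qInner_left x
  have h_int : Integrable (fun a => b (qInner a x) * ‖qInner a h‖ ^ 2) (halfGaussian (QVec d)) := by
    refine (integrable_norm_qInner_sq h).mono'
      (((hb.comp hmx).mul (hmq.norm.pow_const 2)).aestronglyMeasurable)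
      (Filter.Eventually.of_forall fun a => ?_)
    rw [Real.norm_eq_abs, abs_of_nonneg (mul_nonneg (hb0 _) (sq_nonneg _))]
    exact mul_le_of_le_one_left (sq_nonneg _) (hb1 _)
  have hpt : ∀ a, b (qInner a x) * ‖qInner a h‖ ^ 2 =
      (fun p : ℍ[ℝ] × ℍ[ℝ] => b p.1 * ‖p.1 * qInner x h + p.2‖ ^ 2)
        (qInner a x, qInner a (h - rightMul x (qInner x h))) := fun a => by
    simp only [← qInner_eq_add a x h]
  simp only [hpt] at h_int
  refine (integral_congr_ae (Filter.Eventually.of_forall hpt)).trans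
    ((integral_comp_qInner_prod hF hx (qInner_orthogonal_part hx) h_int).trans ?_)
  simp only [integral_const_mul, integral_norm_add_smul_sq, norm_orthogonal_part_sq hx hh,
    norm_mul, mul_pow]
  rw [← integral_const_mul, ← integral_const_mul, ← integral_add
    ((integrable_mul_norm_sq_of_le_one hb hb0 hb1).const_mul _)
    ((integrable_of_le_one hb hb0 hb1).const_mul _)]
  refine integral_congr_ae (Filter.Eventually.of_forall fun q => ?_)
  simp only
  ring

theorem integral_exp_mul_norm_qInner_sq (hx : ‖x‖ = 1) (hh : ‖h‖ = 1) :
    ∫ a, Real.exp (-‖qInner a x‖ ^ 2) * ‖qInner a h‖ ^ 2 ∂(halfGaussian (QVec d)) =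
      expWeightMean - spectralGap * ‖qInner x h‖ ^ 2 := by
  rw [integral_weight_mul_norm_qInner_sq (b := fun q => Real.exp (-‖q‖ ^ 2)) hx hh (by fun_prop)
    (fun q => (Real.exp_pos _).le) exp_neg_norm_sq_le_one, spectralGap, expWeightMean]
  ring

/-- On the ball |q|² ≤ 1 because τ ≤ 1, so the component of h along x contributes no more than an
orthogonal one, for which the integral is exactly the mass of the ball. -/
theorem integral_small_ball_le {τ : ℝ} (hτ : τ ≤ 1) (hx : ‖x‖ = 1) (hh : ‖h‖ = 1) :
    ∫ a, (if ‖qInner a x‖ < τ then ‖qInner a h‖ else 0) ^ 2 ∂(halfGaussian (QVec d)) ≤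
      (halfGaussian ℍ[ℝ]).real (Metric.ball 0 τ) := by
  set b : ℍ[ℝ] → ℝ := (Metric.ball (0 : ℍ[ℝ]) τ).indicator 1 with hbdef
  have hb : Measurable b := measurable_one.indicator measurableSet_ball
  have hbv : ∀ q, b q = if ‖q‖ < τ then 1 else 0 := fun q => by
    classical rw [hbdef, Set.indicator_apply]; simp
  have hb0 : ∀ q, 0 ≤ b q := fun q => by rw [hbv]; split_ifs <;> norm_num
  have hb1 : ∀ q, b q ≤ 1 := fun q => by rw [hbv]; split_ifs <;> norm_num
  have hpt : ∀ a, (if ‖qInner a x‖ < τ then ‖qInner a h‖ else 0) ^ 2 =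
      b (qInner a x) * ‖qInner a h‖ ^ 2 := fun a => by
    rw [hbv]; split_ifs <;> simp
  simp only [hpt]
  rw [integral_weight_mul_norm_qInner_sq hx hh hb hb0 hb1]
  have hval : ∫ q, b q ∂(halfGaussian ℍ[ℝ]) = (halfGaussian ℍ[ℝ]).real (Metric.ball 0 τ) :=
    integral_indicator_one measurableSet_ball
  have hle : ∫ q, b q * ‖q‖ ^ 2 ∂(halfGaussian ℍ[ℝ]) ≤ ∫ q, b q ∂(halfGaussian ℍ[ℝ]) := by
    refine integral_mono (integrable_mul_norm_sq_of_le_one hb hb0 hb1)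
      (integrable_of_le_one hb hb0 hb1) fun q => ?_
    simp only [hbv]
    split_ifs with hq
    · have : ‖q‖ ^ 2 ≤ 1 := pow_le_one₀ (norm_nonneg _) (hq.le.trans hτ)
      linarith
    · simp
  rw [← hval]
  have h0 := mul_le_mul_of_nonneg_left hle (sq_nonneg ‖qInner x h‖)
  linarith

/-- Expected curvature along directions `h` with `x^* h` real. -/
theorem integral_curvature_ge (hx : ‖x‖ = 1) (hh : ‖h‖ = 1) {r : ℝ}
    (hr : qInner x h = (r : ℍ[ℝ])) :
    1 / 4 ≤ ∫ a, (|inner ℝ (qInner a x) (qInner a h)| / ‖qInner a x‖) ^ 2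
      ∂(halfGaussian (QVec d)) := by
  set s := ‖h - rightMul x (qInner x h)‖ with hs
  have hs2 : s ^ 2 = 1 - r ^ 2 := by
    rw [hs, norm_orthogonal_part_sq hx hh, hr, Quaternion.norm_coe, Real.norm_eq_abs, sq_abs]
  have hF : Measurable fun p : ℍ[ℝ] × ℍ[ℝ] =>
      (|inner ℝ p.1 (p.1 * qInner x h + p.2)| / ‖p.1‖) ^ 2 := by
    have h1 : Continuous fun p : ℍ[ℝ] × ℍ[ℝ] => |inner ℝ p.1 (p.1 * qInner x h + p.2)| := by
      fun_prop
    exact (h1.measurable.div measurable_fst.norm).pow_const 2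
  have hpt : ∀ a, (|inner ℝ (qInner a x) (qInner a h)| / ‖qInner a x‖) ^ 2 =
      (fun p : ℍ[ℝ] × ℍ[ℝ] => (|inner ℝ p.1 (p.1 * qInner x h + p.2)| / ‖p.1‖) ^ 2)
        (qInner a x, qInner a (h - rightMul x (qInner x h))) := fun a => by
    simp only [← qInner_eq_add a x h]
  have h_int : Integrable (fun a => (fun p : ℍ[ℝ] × ℍ[ℝ] =>
      (|inner ℝ p.1 (p.1 * qInner x h + p.2)| / ‖p.1‖) ^ 2)
        (qInner a x, qInner a (h - rightMul x (qInner x h)))) (halfGaussian (QVec d)) := by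
    refine (integrable_norm_qInner_sq h).mono' ?_ (Filter.Eventually.of_forall fun a => ?_)
    · exact (hF.comp ((measurable_qInner_left x).prodMk
        (measurable_qInner_left _))).aestronglyMeasurable
    · rw [← hpt, Real.norm_eq_abs, abs_of_nonneg (sq_nonneg _), div_pow, sq_abs, ← div_pow]
      exact sq_inner_div_norm_le _ _
  refine le_of_le_of_eq ?_ ((integral_congr_ae (Filter.Eventually.of_forall hpt)).trans
    (integral_comp_qInner_prod hF hx (qInner_orthogonal_part hx) h_int)).symm
  -- Given a^*x = u ≠ 0, reality of x^*h gives a^*h = ru + sq, so the projection on u is r|u| +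
  -- s⟨u,q⟩/|u|. Averaging over u yields r² + (1-r²)/4.
  have hinner : ∀ᵐ u ∂(halfGaussian ℍ[ℝ]),
      ∫ q, (|inner ℝ u (u * qInner x h + s • q)| / ‖u‖) ^ 2 ∂(halfGaussian ℍ[ℝ]) =
        r ^ 2 * ‖u‖ ^ 2 + s ^ 2 / 4 := by
    have hne : ∀ᵐ u ∂(halfGaussian ℍ[ℝ]), u ≠ 0 := by
      rw [ae_iff]; simpa using halfGaussian_quaternion_singleton_zero
    filter_upwards [hne] with u hu
    have hu0 : ‖u‖ ≠ 0 := norm_ne_zero_iff.2 hu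
    have e : ∀ q, (|inner ℝ u (u * qInner x h + s • q)| / ‖u‖) ^ 2 =
        r ^ 2 * ‖u‖ ^ 2 + 2 * r * s * inner ℝ u q + s ^ 2 / ‖u‖ ^ 2 * inner ℝ u q ^ 2 := by
      intro q
      rw [hr, ← Quaternion.coe_commutes, Quaternion.coe_mul_eq_smul, inner_add_right,
        real_inner_smul_right, real_inner_smul_right, real_inner_self_eq_norm_sq, div_pow, sq_abs]
      field_simp
      ring
    have i1 : Integrable (fun q => r ^ 2 * ‖u‖ ^ 2 + 2 * r * s * inner ℝ u q)
        (halfGaussian ℍ[ℝ]) :=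
      (integrable_const _).add ((integrable_inner_halfGaussian u).const_mul _)
    simp only [e]
    rw [integral_add i1 ((integrable_inner_sq_halfGaussian u).const_mul _),
      integral_add (integrable_const _) ((integrable_inner_halfGaussian u).const_mul _),
      integral_const_mul (s ^ 2 / ‖u‖ ^ 2), integral_const_mul (2 * r * s),
      integral_inner_halfGaussian, integral_inner_sq_halfGaussian]
    simp only [integral_const, probReal_univ, one_smul, mul_zero, add_zero]
    field_simp
  rw [integral_congr_ae hinner, integral_add ((integrable_norm_pow_halfGaussian 2).const_mul _)
    (integrable_const _), integral_const_mul, integral_norm_sq_quaternion]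
  simp only [integral_const, probReal_univ, one_smul, mul_one, hs2]
  nlinarith [sq_nonneg r]

/-- The fourth moment suffices: T(|q|-T)₊ ≤ |q|², so the squared excess is at most |q|⁴/T². -/
theorem exists_integral_excess_le {ε : ℝ} (hε : 0 < ε) :
    ∃ T : ℝ, 0 < T ∧ ∀ {d : ℕ} {h : QVec d}, ‖h‖ = 1 →
      ∫ a, max (‖qInner a h‖ - T) 0 ^ 2 ∂(halfGaussian (QVec d)) ≤ ε := by
  set K := ∫ q, ‖q‖ ^ 4 ∂(halfGaussian ℍ[ℝ]) with hK
  have hK0 : 0 ≤ K := integral_nonneg fun q => by positivity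
  refine ⟨√((K + 1) / ε), Real.sqrt_pos.2 (by positivity), fun {d h} hh => ?_⟩
  set T := √((K + 1) / ε) with hT
  have hT0 : 0 < T := Real.sqrt_pos.2 (by positivity)
  have hT2 : T ^ 2 = (K + 1) / ε := Real.sq_sqrt (by positivity)
  rw [integral_comp_qInner (F := fun q => max (‖q‖ - T) 0 ^ 2) (by fun_prop), hh]
  simp only [one_smul]
  have hpt : ∀ q : ℍ[ℝ], max (‖q‖ - T) 0 ^ 2 ≤ ‖q‖ ^ 4 / T ^ 2 := by
    intro q
    rw [le_div_iff₀ (by positivity), ← mul_pow]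
    rcases le_total (‖q‖ - T) 0 with h1 | h1
    · rw [max_eq_right h1]; simp
    · rw [max_eq_left h1]
      have h2 : (‖q‖ - T) * T ≤ ‖q‖ ^ 2 := by nlinarith [norm_nonneg q]
      calc ((‖q‖ - T) * T) ^ 2 ≤ (‖q‖ ^ 2) ^ 2 := by
            have : 0 ≤ (‖q‖ - T) * T := by positivity
            gcongr
        _ = _ := by ring
  have i4 := (integrable_norm_pow_halfGaussian (E := ℍ[ℝ]) 4).div_const (T ^ 2)
  have i1 : Integrable (fun q : ℍ[ℝ] => max (‖q‖ - T) 0 ^ 2) (halfGaussian ℍ[ℝ]) := by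
    refine i4.mono' (Measurable.aestronglyMeasurable (by fun_prop))
      (Filter.Eventually.of_forall fun q => ?_)
    rw [Real.norm_eq_abs, abs_of_nonneg (sq_nonneg _)]
    exact hpt q
  calc _ ≤ ∫ q, ‖q‖ ^ 4 / T ^ 2 ∂(halfGaussian ℍ[ℝ]) := integral_mono i1 i4 hpt
    _ = K / T ^ 2 := by rw [integral_div]
    _ ≤ ε := by
      rw [hT2, div_div_eq_mul_div, div_le_iff₀ (by linarith)]
      nlinarith

end Expectations

/-! ### The good event -/

section GoodEvent

variable {d n : ℕ}

/-- Extends bounds from unit vectors to all h; the predicate p allows the restriction to h with x^*h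
real. -/
theorem le_mul_norm_sq_of_homogeneous {p : QVec d → Prop} {Q : QVec d → ℝ} {c : ℝ}
    (hp : ∀ (r : ℝ) h, p h → p (r • h)) (hQ : ∀ (r : ℝ) h, 0 ≤ r → Q (r • h) = r ^ 2 * Q h)
    (hunit : ∀ h, p h → ‖h‖ = 1 → Q h ≤ c) {h : QVec d} (hh : p h) : Q h ≤ c * ‖h‖ ^ 2 := by
  rcases eq_or_ne h 0 with rfl | h0
  · have := hQ 0 0 le_rfl
    simp only [smul_zero] at this
    have h0 : Q 0 = 0 := this.trans (by ring)
    rw [h0]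
    simp
  · have hn : 0 < ‖h‖ := norm_pos_iff.2 h0
    have h1 := hunit (‖h‖⁻¹ • h) (hp _ _ hh) (by simp [norm_smul, hn.ne'])
    have h2 := hQ ‖h‖ (‖h‖⁻¹ • h) hn.le
    rw [smul_smul, mul_inv_cancel₀ hn.ne', one_smul] at h2
    rw [h2, mul_comm]
    gcongr

/-- The conclusions of the main theorem hold whenever the empirical quadratic forms are close to
their expectations. -/
theorem conclusion_of_bounds {σ γ δ δ' τ T ρ ε q κ : ℝ} (hσ : 0 < σ) (hδ0 : 0 < δ)
    (hδ1 : δ ≤ 1)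
    (hδσ : 3 * δ / σ * 2 ≤ 1 / (64 * (4 + σ))) (hε : 2 * (ε + ε) ≤ 1 / (64 * (4 + σ)))
    (hT : 0 < T) (hρ0 : 0 ≤ ρ) (hρ : 2 * T * ρ ≤ δ * τ) (hκ : 0 < κ) (hδ'0 : 0 < δ')
    (hδ' : δ' ≤ 1 / 2) (hδ'ρ : δ' * (1 + (40 + 8 * |γ|) / κ) ≤ ρ ^ 2)
    {A : Fin n → QVec d} {x e : QVec d} (hx : x ≠ 0) (he : e = ‖x‖⁻¹ • x)
    (hM : ∀ h, ‖h‖ = 1 → |(1 / (n : ℝ)) * ∑ k, ‖qInner (A k) h‖ ^ 2 - 1| ≤ δ')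
    (hC : ∀ h, ‖h‖ = 1 → (∃ r : ℝ, qInner e h = (r : ℍ[ℝ])) → 1 / 8 ≤ (1 / (n : ℝ)) *
      ∑ k, (|inner ℝ (qInner (A k) e) (qInner (A k) h)| / ‖qInner (A k) e‖) ^ 2)
    (hB : ∀ h, ‖h‖ = 1 → (1 / (n : ℝ)) * ∑ k, (if ‖qInner (A k) e‖ < τ then
      ‖qInner (A k) h‖ else 0) ^ 2 ≤ ε)
    (hA : ∀ h, ‖h‖ = 1 → (1 / (n : ℝ)) * ∑ k, max (‖qInner (A k) h‖ - T) 0 ^ 2 ≤ ε / 4)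
    (hE : ∀ h, ‖h‖ = 1 → |(1 / (n : ℝ)) * ∑ k,
      Real.exp (-‖qInner (A k) e‖ ^ 2) * ‖qInner (A k) h‖ ^ 2
        - (q - κ * ‖qInner e h‖ ^ 2)| ≤ δ') :
    LRC (gradient A (amplitudes A x) (perturbation σ (amplitudes A x))) x
        (1 / (128 * (4 + σ))) (1 / (16 * (4 + σ))) ρ ∧
      (∃ v, IsLeadingEigenvector (initMatrix A (amplitudes A x) γ) v) ∧
      ∀ v : QVec d, IsLeadingEigenvector (initMatrix A (amplitudes A x) γ) v →
        ∀ z₀ : QVec d, z₀ = normEstimate (amplitudes A x) • v →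
        phaseDist z₀ x ≤ ρ * ‖x‖ ∧
        ∀ η : ℝ, 0 < η → η ≤ 1 / (128 * (4 + σ)) → ∀ t : ℕ,
          phaseDist (iterates A (amplitudes A x) σ η z₀ t) x ^ 2
            ≤ (1 - 1 / (16 * (4 + σ)) * η) ^ t * phaseDist z₀ x ^ 2 := by
  have hn0 : (0 : ℝ) ≤ 1 / (n : ℝ) := by positivity
  have hxn : 0 < ‖x‖ := norm_pos_iff.2 hx
  have hxe : x = ‖x‖ • e := by rw [he, smul_smul, mul_inv_cancel₀ hxn.ne', one_smul]
  have hxA : ∀ k, qInner (A k) x = ‖x‖ • qInner (A k) e := fun k => by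
    rw [← qInner_smul_right, ← hxe]
  have hlrc : LRC (gradient A (amplitudes A x) (perturbation σ (amplitudes A x))) x
      (1 / (128 * (4 + σ))) (1 / (16 * (4 + σ))) ρ := by
    refine lrc_of_bounds (τ := τ) (T := 2 * T) hσ hδ0 hδ1 hδσ hε (by positivity) hρ A x ?_ ?_ ?_ ?_
    · intro h
      refine le_mul_norm_sq_of_homogeneous (p := fun _ => True)
        (Q := fun h => (1 / (n : ℝ)) * ∑ k, ‖qInner (A k) h‖ ^ 2) (fun _ _ _ => trivial) ?_ ?_
        trivial
      · intro r h _
        simp only [qInner_smul_right, norm_smul, mul_pow, Real.norm_eq_abs, sq_abs,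
          ← Finset.mul_sum]
        ring
      · intro h _ hh
        linarith [(abs_le.1 (hM h hh)).2]
    · intro h hr
      -- The lower bound is obtained from the upper-bound lemma for the negated form.
      have key := le_mul_norm_sq_of_homogeneous
        (p := fun h => ∃ r : ℝ, qInner x h = (r : ℍ[ℝ]))
        (Q := fun h => -((1 / (n : ℝ)) * ∑ k,
          (inner ℝ (qInner (A k) x) (qInner (A k) h) / ‖qInner (A k) x‖) ^ 2))
        (c := -(1 / 8)) ?_ ?_ ?_ hr
      · linarith
      · rintro r h ⟨s, hs⟩
        refine ⟨r * s, ?_⟩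
        rw [qInner_smul_right, hs, ← Quaternion.coe_smul, smul_eq_mul]
      · intro r h _
        simp only [qInner_smul_right, real_inner_smul_right, mul_div_assoc, mul_pow,
          ← Finset.mul_sum]
        ring
      · rintro h ⟨s, hs⟩ hh
        have h1 := hC h hh ⟨‖x‖⁻¹ * s, by
          rw [he, qInner_smul_left, hs, ← Quaternion.coe_smul, smul_eq_mul]⟩
        refine neg_le_neg (h1.trans (le_of_eq ?_))
        congr 1
        refine Finset.sum_congr rfl fun k _ => ?_
        rw [hxA, real_inner_smul_left, norm_smul, norm_norm, mul_div_mul_left _ _ hxn.ne',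
          div_pow, div_pow, sq_abs]
    · intro h
      refine le_mul_norm_sq_of_homogeneous (p := fun _ => True)
        (Q := fun h => (1 / (n : ℝ)) * ∑ k, (if ‖qInner (A k) x‖ < τ * ‖x‖ then
          ‖qInner (A k) h‖ ^ 2 else 0)) (fun _ _ _ => trivial) ?_ ?_ trivial
      · intro r h _
        simp only [qInner_smul_right, norm_smul, mul_pow, Real.norm_eq_abs, sq_abs]
        rw [mul_left_comm (r ^ 2), Finset.mul_sum (a := r ^ 2)]
        congr 1
        exact Finset.sum_congr rfl fun k _ => by split_ifs <;> simp
      · intro h _ hh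
        refine le_trans (le_of_eq ?_) (hB h hh)
        congr 1
        refine Finset.sum_congr rfl fun k _ => ?_
        simp only [hxA, norm_smul, norm_norm, mul_comm ‖x‖, mul_lt_mul_iff_left₀ hxn]
        split_ifs <;> simp
    · intro h
      refine le_mul_norm_sq_of_homogeneous (p := fun _ => True)
        (Q := fun h => (1 / (n : ℝ)) * ∑ k, (if 2 * T * ‖h‖ < ‖qInner (A k) h‖ then
          ‖qInner (A k) h‖ ^ 2 else 0)) (fun _ _ _ => trivial) ?_ ?_ trivial
      · intro r h hr
        rcases hr.eq_or_lt with rfl | hr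
        · simp [qInner_zero_right]
        · simp only [qInner_smul_right, norm_smul, mul_pow, Real.norm_eq_abs, sq_abs]
          rw [mul_left_comm (r ^ 2), Finset.mul_sum (a := r ^ 2)]
          congr 1
          refine Finset.sum_congr rfl fun k _ => ?_
          simp only [mul_left_comm (2 * T), abs_of_pos hr, mul_lt_mul_iff_right₀ hr]
          split_ifs <;> simp
      · intro h _ hh
        have h1 := hA h hh
        -- Above level 2T one has |v| ≤ 2(|v|-T), so the hard cutoff is dominated by four times the
        -- Lipschitz excess. This explains ε/4 and the cutoff 2T.
        have h2 : (1 / (n : ℝ)) * ∑ k, (if 2 * T * ‖h‖ < ‖qInner (A k) h‖ then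
            ‖qInner (A k) h‖ ^ 2 else 0) ≤
            (1 / (n : ℝ)) * ∑ k, 4 * max (‖qInner (A k) h‖ - T) 0 ^ 2 := by
          refine mul_le_mul_of_nonneg_left (Finset.sum_le_sum fun k _ => ?_) hn0
          split_ifs with hk
          · rw [hh, mul_one] at hk
            have h3 : ‖qInner (A k) h‖ ≤ 2 * max (‖qInner (A k) h‖ - T) 0 := by
              have := le_max_left (‖qInner (A k) h‖ - T) 0
              linarith
            calc ‖qInner (A k) h‖ ^ 2 ≤ (2 * max (‖qInner (A k) h‖ - T) 0) ^ 2 := by gcongr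
              _ = _ := by ring
          · positivity
        rw [← Finset.mul_sum] at h2
        linarith
  refine ⟨hlrc, exists_isLeadingEigenvector A _ γ hx, ?_⟩
  rintro v hv z₀ rfl
  have hinit := phaseDist_initial_le hκ hδ'0 hδ' hρ0 hδ'ρ hx hM (he ▸ hE) hv
  refine ⟨hinit, fun η hη hημ t => ?_⟩
  refine phaseDist_iterates_sq_le (μ := 1 / (128 * (4 + σ))) (by positivity) ?_ hlrc hη hημ hinit t
  have h1 : 1 / (16 * (4 + σ)) < 1 := by rw [div_lt_one (by positivity)]; linarith
  have h2 : 1 / (128 * (4 + σ)) < 1 := by rw [div_lt_one (by positivity)]; linarith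
  exact mul_lt_one_of_nonneg_of_lt_one_left (by positivity) h1 h2.le

theorem abs_abs_div_sub_abs_div_le (u v w : ℍ[ℝ]) :
    |(|inner ℝ u v| / ‖u‖) - |inner ℝ u w| / ‖u‖| ≤ ‖v - w‖ := by
  rw [← sub_div, abs_div, abs_norm]
  rcases (norm_nonneg u).eq_or_lt with h | h
  · simp [← h]
  · rw [div_le_iff₀ h]
    calc _ ≤ |inner ℝ u v - inner ℝ u w| := abs_abs_sub_abs_le_abs_sub _ _
      _ = |inner ℝ u (v - w)| := by rw [inner_sub_right]
      _ ≤ ‖u‖ * ‖v - w‖ := abs_real_inner_le_norm _ _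
      _ = _ := mul_comm _ _

end GoodEvent

end QPAF

end

/-! ### Choice of constants and assembly. -/

theorem mainTheorem3 (σ : ℝ) (hσ : 0 < σ) (γ : ℝ) :
    -- the search direction is twice the generalized `ℍℝ` gradient of the objective
    (∀ (d n : ℕ) (A : Fin n → QPAF.QVec d) (x z : QPAF.QVec d),
      DifferentiableAt ℝ (QPAF.loss A (QPAF.amplitudes A x)
        (QPAF.perturbation σ (QPAF.amplitudes A x))) z ∧
      QPAF.gradient A (QPAF.amplitudes A x) (QPAF.perturbation σ (QPAF.amplitudes A x)) z =
        (2 : ℝ) • QPAF.ghrGradient (QPAF.loss A (QPAF.amplitudes A x)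
          (QPAF.perturbation σ (QPAF.amplitudes A x))) z) ∧
    -- local regularity, accuracy of the initial guess, and linear convergence
    ∃ C c₁ c₂ μ lam ρ : ℝ, 0 < C ∧ 0 < c₁ ∧ 0 < c₂ ∧ 0 < μ ∧ 0 < lam ∧ lam * μ < 1 ∧
      0 < ρ ∧ ρ < 1 ∧
      ∀ (d n : ℕ) (x : QPAF.QVec d), x ≠ 0 → C * (d : ℝ) ≤ (n : ℝ) →
      ∀ (Ω : Type*) [MeasurableSpace Ω] (P : MeasureTheory.Measure Ω)
        [MeasureTheory.IsProbabilityMeasure P] (α : Fin n → Ω → QPAF.QVec d),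
        QPAF.IsQuaternionGaussian P α →
        P {ω | ¬ (
          QPAF.LRC (QPAF.gradient (fun k => α k ω) (QPAF.amplitudes (fun k => α k ω) x)
            (QPAF.perturbation σ (QPAF.amplitudes (fun k => α k ω) x))) x μ lam ρ ∧
          (∃ v, QPAF.IsLeadingEigenvector
            (QPAF.initMatrix (fun k => α k ω) (QPAF.amplitudes (fun k => α k ω) x) γ) v) ∧
          ∀ v : QPAF.QVec d, QPAF.IsLeadingEigenvector
              (QPAF.initMatrix (fun k => α k ω) (QPAF.amplitudes (fun k => α k ω) x) γ) v →
            ∀ z₀ : QPAF.QVec d,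
              z₀ = QPAF.normEstimate (QPAF.amplitudes (fun k => α k ω) x) • v →
            QPAF.phaseDist z₀ x ≤ ρ * ‖x‖ ∧
            ∀ η : ℝ, 0 < η → η ≤ μ → ∀ t : ℕ,
              QPAF.phaseDist (QPAF.iterates (fun k => α k ω)
                  (QPAF.amplitudes (fun k => α k ω) x) σ η z₀ t) x ^ 2
                ≤ (1 - lam * η) ^ t * QPAF.phaseDist z₀ x ^ 2)}
          ≤ ENNReal.ofReal (c₁ * Real.exp (-(c₂ * (n : ℝ)))) := by
  refine ⟨fun d n A x z => ⟨
    (QPAF.hasFDerivAt_loss A (QPAF.perturbation_eq_zero hσ _) z).differentiableAt,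
    QPAF.gradient_eq_two_smul_ghrGradient A (QPAF.perturbation_eq_zero hσ _) z⟩, ?_⟩
  have h4σ : 0 < 4 + σ := by linarith
  -- the constants
  obtain ⟨δ, hδ0, hδ1, hδσ⟩ : ∃ δ : ℝ, 0 < δ ∧ δ ≤ 1 ∧ 3 * δ / σ * 2 ≤ 1 / (64 * (4 + σ)) := by
    refine ⟨min 1 (σ / (384 * (4 + σ))), lt_min one_pos (by positivity), min_le_left _ _, ?_⟩
    calc 3 * min 1 (σ / (384 * (4 + σ))) / σ * 2 ≤ 3 * (σ / (384 * (4 + σ))) / σ * 2 := by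
          gcongr; exact min_le_right _ _
      _ = 1 / (64 * (4 + σ)) := by field_simp; norm_num
  obtain ⟨ε, hε0, hε⟩ : ∃ ε : ℝ, 0 < ε ∧ 2 * (ε + ε) ≤ 1 / (64 * (4 + σ)) :=
    ⟨1 / (256 * (4 + σ)), by positivity, le_of_eq (by field_simp; norm_num)⟩
  -- The expectations are made at most ε/2 and ε/8, leaving room for the deviation δ' ≤ ε/8 below
  -- the required ε and ε/4.
  obtain ⟨τ, hτ0, hτ1, hτ⟩ := QPAF.exists_halfGaussian_ball_le (half_pos hε0)
  obtain ⟨T, hT0, hT⟩ := QPAF.exists_integral_excess_le (show 0 < ε / 8 by positivity)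
  obtain ⟨ρ, hρ0, hρ1, hρ⟩ : ∃ ρ : ℝ, 0 < ρ ∧ ρ < 1 ∧ 2 * T * ρ ≤ δ * τ := by
    refine ⟨min (1 / 2) (δ * τ / (2 * T)), lt_min (by norm_num) (by positivity),
      (min_le_left _ _).trans_lt (by norm_num), ?_⟩
    calc 2 * T * min (1 / 2) (δ * τ / (2 * T)) ≤ 2 * T * (δ * τ / (2 * T)) := by
          gcongr; exact min_le_right _ _
      _ = δ * τ := by field_simp
  have hκ := QPAF.spectralGap_pos
  have hfac : 0 < 1 + (40 + 8 * |γ|) / QPAF.spectralGap := by positivity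
  -- The accuracy δ' is fixed after ρ, so the initial guess lands in the region; δ' ≤ 1/8 keeps the
  -- curvature above 1/4 - 1/8.
  obtain ⟨δ', hδ'0, hδ'2, hδ'ρ, hδ'8, hδ'ε⟩ : ∃ δ' : ℝ, 0 < δ' ∧ δ' ≤ 1 / 2 ∧
      δ' * (1 + (40 + 8 * |γ|) / QPAF.spectralGap) ≤ ρ ^ 2 ∧ δ' ≤ 1 / 8 ∧ δ' ≤ ε / 8 := by
    refine ⟨min (1 / 8) (min (ε / 8) (ρ ^ 2 / (1 + (40 + 8 * |γ|) / QPAF.spectralGap))),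
      lt_min (by norm_num) (lt_min (by positivity) (by positivity)),
      (min_le_left _ _).trans (by norm_num), ?_, min_le_left _ _,
      (min_le_right _ _).trans (min_le_left _ _)⟩
    rw [← le_div_iff₀ hfac]
    exact (min_le_right _ _).trans (min_le_right _ _)
  obtain ⟨C, c₁, c₂, hC, hc₁, hc₂, H⟩ := QPAF.exists_uniform_concentration hδ'0
  refine ⟨C, 5 * c₁, c₂, 1 / (128 * (4 + σ)), 1 / (16 * (4 + σ)), ρ, hC, by positivity, hc₂,
    by positivity, by positivity, ?_, hρ0, hρ1, ?_⟩
  · have h1 : 1 / (16 * (4 + σ)) < 1 := by rw [div_lt_one (by positivity)]; linarith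
    have h2 : 1 / (128 * (4 + σ)) < 1 := by rw [div_lt_one (by positivity)]; linarith
    exact mul_lt_one_of_nonneg_of_lt_one_left (by positivity) h1 h2.le
  intro d n x hx hdn Ω _ P _ α hα
  obtain ⟨e, he⟩ : ∃ e, e = ‖x‖⁻¹ • x := ⟨_, rfl⟩
  have he1 : ‖e‖ = 1 := by simp [he, norm_smul, norm_ne_zero_iff.2 hx]
  have hme := QPAF.measurable_qInner_left e
  -- the five concentration events
  have b1 := H hdn hα (S := {h | ‖h‖ = 1}) (G := fun a h => ‖QPAF.qInner a h‖) (fun h hh => hh)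
    (fun h _ => (QPAF.measurable_qInner_left h).norm) (fun a h _ => norm_nonneg _)
    (fun a h _ => le_rfl) (fun a h _ y _ => by
      rw [QPAF.qInner_sub_right]; exact abs_norm_sub_norm_le _ _)
  have b2 := H hdn hα (S := {h | ‖h‖ = 1 ∧ ∃ r : ℝ, QPAF.qInner e h = (r : ℍ[ℝ])})
    (G := fun a h => |inner ℝ (QPAF.qInner a e) (QPAF.qInner a h)| / ‖QPAF.qInner a e‖)
    (fun h hh => hh.1)
    (fun h _ => ((hme.inner (QPAF.measurable_qInner_left h)).abs).div hme.norm)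
    (fun a h _ => by positivity)
    (fun a h _ => by
      have := QPAF.sq_inner_div_norm_le (QPAF.qInner a e) (QPAF.qInner a h)
      rw [div_pow, ← sq_abs, ← div_pow] at this
      exact (pow_le_pow_iff_left₀ (by positivity) (norm_nonneg _) two_ne_zero).1 this)
    (fun a h _ y _ => by
      rw [QPAF.qInner_sub_right]; exact QPAF.abs_abs_div_sub_abs_div_le _ _ _)
  -- The indicator depends on a^*e alone, so its jump does not affect the Lipschitz bound in h.
  have b3 := H hdn hα (S := {h | ‖h‖ = 1})
    (G := fun a h => if ‖QPAF.qInner a e‖ < τ then ‖QPAF.qInner a h‖ else 0) (fun h hh => hh)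
    (fun h _ => Measurable.ite (measurableSet_lt hme.norm measurable_const)
      (QPAF.measurable_qInner_left h).norm measurable_const)
    (fun a h _ => by split_ifs <;> positivity)
    (fun a h _ => by split_ifs <;> simp)
    (fun a h _ y _ => by
      rw [QPAF.qInner_sub_right]
      split_ifs
      · exact abs_norm_sub_norm_le _ _
      · simp)
  have b4 := H hdn hα (S := {h | ‖h‖ = 1})
    (G := fun a h => max (‖QPAF.qInner a h‖ - T) 0) (fun h hh => hh)
    (fun h _ => ((QPAF.measurable_qInner_left h).norm.sub_const T).max measurable_const)
    (fun a h _ => le_max_right _ _)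
    (fun a h _ => max_le (by linarith) (norm_nonneg _))
    (fun a h _ y _ => by
      rw [QPAF.qInner_sub_right]
      refine (abs_max_sub_max_le_abs _ _ _).trans ?_
      rw [sub_sub_sub_cancel_right]
      exact abs_norm_sub_norm_le _ _)
  -- The weight enters as its square root because the uniform law concerns G².
  have b5 := H hdn hα (S := {h | ‖h‖ = 1})
    (G := fun a h => Real.exp (-‖QPAF.qInner a e‖ ^ 2 / 2) * ‖QPAF.qInner a h‖) (fun h hh => hh)
    (fun h _ => (((hme.norm.pow_const 2).neg.div_const 2).exp).mul
      (QPAF.measurable_qInner_left h).norm)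
    (fun a h _ => by positivity)
    (fun a h _ => mul_le_of_le_one_left (norm_nonneg _)
      (Real.exp_le_one_iff.2 (by have := sq_nonneg ‖QPAF.qInner a e‖; linarith)))
    (fun a h _ y _ => by
      rw [QPAF.qInner_sub_right, ← mul_sub, abs_mul, abs_of_pos (Real.exp_pos _)]
      exact (mul_le_of_le_one_left (abs_nonneg _) (Real.exp_le_one_iff.2
        (by have := sq_nonneg ‖QPAF.qInner a e‖; linarith))).trans (abs_norm_sub_norm_le _ _))
  -- A union bound over the five events, whence the constant 5c₁.
  refine (measure_mono ?_).trans ((measure_union_le _ _).trans ((add_le_add ((measure_union_le _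
    _).trans (add_le_add ((measure_union_le _ _).trans (add_le_add ((measure_union_le _ _).trans
    (add_le_add b1 b2)) b3)) b4)) b5).trans ?_))
  · intro ω hω
    by_contra hnot
    simp only [Set.mem_union, Set.mem_ofPred_eq, not_or, not_not] at hnot
    obtain ⟨⟨⟨⟨g1, g2⟩, g3⟩, g4⟩, g5⟩ := hnot
    refine hω (QPAF.conclusion_of_bounds (T := T) (τ := τ) (ε := ε) (δ := δ) (δ' := δ')
      (q := QPAF.expWeightMean) (κ := QPAF.spectralGap) hσ hδ0 hδ1 hδσ hε hT0 hρ0.le hρ hκ hδ'0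
      hδ'2 hδ'ρ hx he ?_ ?_ ?_ ?_ ?_)
    · intro h hh
      have := g1 h hh
      rwa [QPAF.integral_norm_qInner_sq, hh, one_pow] at this
    · rintro h hh ⟨r, hr⟩
      have h1 := (abs_le.1 (g2 h ⟨hh, r, hr⟩)).1
      have h2 := QPAF.integral_curvature_ge he1 hh hr
      linarith
    · intro h hh
      have h1 := (abs_le.1 (g3 h hh)).2
      have h2 := (QPAF.integral_small_ball_le hτ1 he1 hh).trans hτ
      linarith
    · intro h hh
      have h1 := (abs_le.1 (g4 h hh)).2
      have h2 := hT hh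
      linarith
    · intro h hh
      have h1 := g5 h hh
      have e1 : ∀ a, (Real.exp (-‖QPAF.qInner a e‖ ^ 2 / 2) * ‖QPAF.qInner a h‖) ^ 2 =
          Real.exp (-‖QPAF.qInner a e‖ ^ 2) * ‖QPAF.qInner a h‖ ^ 2 := fun a => by
        rw [mul_pow, ← Real.exp_nat_mul]
        congr 2
        push_cast
        ring
      simp only [e1] at h1
      rwa [QPAF.integral_exp_mul_norm_qInner_sq he1 hh] at h1
  · rw [← ENNReal.ofReal_add (by positivity) (by positivity),
      ← ENNReal.ofReal_add (by positivity) (by positivity),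
      ← ENNReal.ofReal_add (by positivity) (by positivity),
      ← ENNReal.ofReal_add (by positivity) (by positivity)]
    exact ENNReal.ofReal_le_ofReal (by linarith)
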